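/- Let $q\ge 3$ be an integer, $\lambda=2\cos(\pi/q)$, and in $\mathrm{PSL}(2,\mathbb R)$ put $S=\begin{pmatrix}0&-1\\1&0\end{pmatrix}$, $U=\begin{pmatrix}\lambda&-1\\1&0\end{pmatrix}$, $\mathcal T=\tfrac1{\sqrt2}\begin{pmatrix}1&-1\\1&1\end{pmatrix}$, $g_k=(U^kS)^{-1}$ and $h_k=\mathcal T g_k\mathcal T^{-1}$ for $1\le k\le q-1$; matrices act on $\mathbb C\cup\{\infty\}$ by fractional linear transformations $a.z$. For $a^{-1}=\begin{pmatrix}\alpha&\beta\\ \gamma&\delta\end{pmatrix}$ and $s\in\mathbb C$ put $\tau_s(a)f(z)=\big((\gamma z+\delta)^{-2}\big)^s f(a^{-1}.z)$, with the principal power. Let $E_1=\big(\tfrac{\lambda-1}{\lambda+1},1\big)$, $E_r=\big(-\tfrac{\lambda-1}{\lambda+1},\tfrac{\lambda-1}{\lambda+1}\big)$, $E_{q-1}=\big(-1,-\tfrac{\lambda-1}{\lambda+1}\big)$. Let $\mathcal E_1,\mathcal E_r,\mathcal E_{q-1}\subseteq\mathbb C$ be any bounded connected (non-empty) open sets such that: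 - $\overline{E_j}\subseteq\mathcal E_j$ for $j\in\{1,r,q-1\}$; $-\mathcal E_r=\mathcal E_r$ and $-\mathcal E_1=\mathcal E_{q-1}$; - for $2\le k\le q-2$ and $j\in\{1,r,q-1\}$: $h_k^{-1}.\overline{\mathcal E_j}\subseteq\mathcal E_r$, and the number $(\gamma z+\delta)^{-2}$, where $(\gamma,\delta)$ is the lower row of $h_k^{-1}$, is not in $(-\infty,0]$ for any $z\in\overline{\mathcal E_j}$; - for all integers $n\ge1$: $h_1^{-n}.\overline{\mathcal E_j}\subseteq\mathcal E_1$ for $j\in\{r,q-1\}$, and $h_{q-1}^{-n}.\overline{\mathcal E_j}\subseteq\mathcal E_{q-1}$ for $j\in\{1,r\}$; - $\operatorname{Re}z>-1$ on $\overline{\mathcal E_1}$, $\operatorname{Re}z<1$ on $\overline{\mathcal E_{q-1}}$, and $-1<\operatorname{Re}z<1$ on $\overline{\mathcal E_r}$. Let $B(\mathcal E_j)$ be the space of holomorphic functions on $\mathcal E_j$ that extend continuously to $\overline{\mathcal E_j}$, with the supremum norm, and $B(\mathcal E)=B(\mathcal E_1)\times B(\mathcal E_r)\times B(\mathcal E_{q-1})$.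 For $\operatorname{Re}s>\tfrac12$ the transfer operator $\mathcal L_{H,s}$ acts on $f=(f_1,f_r,f_{q-1})\in B(\mathcal E)$ by $$\mathcal L_{H,s}f=\begin{pmatrix}\sum_{k=2}^{q-2}\tau_s(h_k)f_r+\sum_{n\ge1}\tau_s(h_{q-1}^n)f_{q-1}\\ \sum_{n\ge1}\tau_s(h_1^n)f_1+\sum_{k=2}^{q-2}\tau_s(h_k)f_r+\sum_{n\ge1}\tau_s(h_{q-1}^n)f_{q-1}\\ \sum_{n\ge1}\tau_s(h_1^n)f_1+\sum_{k=2}^{q-2}\tau_s(h_k)f_r\end{pmatrix}.$$ A bounded operator $L$ on a Banach space $X$ is nuclear of order $0$ if for every $p\in(0,1]$ it can be written $Lx=\sum_n c_n\varphi_n(x)y_n$ with $\varphi_n\in X'$, $y_n\in X$ of norm at most $1$ and $\sum_n|c_n|^p<\infty$. **Proposition.** The map $s\mapsto\mathcal L_{H,s}$ extends to a meromorphic function on $\mathbb C$ with values in nuclear operators of order $0$ on $B(\mathcal E)$, with possible poles in $P=\{(1-k)/2: k=0,1,2,\dots\}$. That is, there are bounded operators $\widetilde{\mathcal L}_{H,s}$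 on $B(\mathcal E)$ for $s\in\mathbb C\setminus P$, nuclear of order $0$, such that for $\operatorname{Re}s>\tfrac12$ the series defining $\mathcal L_{H,s}f$ converge pointwise on the domains $\mathcal E_j$ for all $f\in B(\mathcal E)$ and $\widetilde{\mathcal L}_{H,s}=\mathcal L_{H,s}$; the set $P$ is closed and discrete; for each $f\in B(\mathcal E)$ and each $j\in\{1,r,q-1\}$, the function $s\mapsto(\widetilde{\mathcal L}_{H,s}f)_j(z)$ is, for each $z\in\mathcal E_j$, meromorphic on $\mathbb C$ with poles only in $P$, and the map $(s,z)\mapsto(\widetilde{\mathcal L}_{H,s}f)_j(z)$ is continuous on $(\mathbb C\setminus P)\times\mathcal E_j$. All poles are simple, and each $s_0\in P$ has an open neighbourhood $V$ on which there are operator-norm holomorphic families $\mathcal A_s,\mathcal B_s$ of bounded operators on $B(\mathcal E)$ with $$\widetilde{\mathcal L}_{H,s}=\frac1{s-s_0}\mathcal A_s+\mathcal B_s\qquad(s\in V\setminus\{s_0\})$$ and $\operatorname{rank}\mathcal A_s\le4$ for all $s\in V$. -/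

import Mathlib

open Complex Set Filter Topology
open scoped BoundedContinuousFunction

noncomputable section

namespace HeckeTransfer

/-! ## The Hecke triangle group elements, conjugated to a bounded interval -/

/-- The translation length `λ = 2 cos (π / q)`. -/
def lam (q : ℕ) : ℝ := 2 * Real.cos (Real.pi / q)

/-- Elements of `PSL(2, ℝ)` are represented by matrices in `SL(2, ℝ)`; everything below is
insensitive to the sign of the representative. -/
abbrev SL2R : Type := Matrix.SpecialLinearGroup (Fin 2) ℝ

def S : SL2R := ⟨!![0, -1; 1, 0], by simp [Matrix.det_fin_two]⟩

def U (q : ℕ) : SL2R := ⟨!![lam q, -1; 1, 0], by simp [Matrix.det_fin_two]⟩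

/-- `g_k = (U ^ k S)⁻¹`. -/
def g (q k : ℕ) : SL2R := (U q ^ k * S)⁻¹

/-- The transformation `t ↦ (t - 1) / (t + 1)`. -/
def calT : SL2R :=
  ⟨!![1 / √2, -(1 / √2); 1 / √2, 1 / √2], by
    rw [Matrix.det_fin_two]
    have h2 : (√2 : ℝ) * √2 = 2 := Real.mul_self_sqrt (by norm_num)
    have h0 : (√2 : ℝ) ≠ 0 := by positivity
    simp only [Matrix.of_apply, Matrix.cons_val', Matrix.cons_val_zero, Matrix.cons_val_one,
      Matrix.cons_val_fin_one]
    field_simp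
    linarith⟩

/-- `h_k = 𝒯 g_k 𝒯⁻¹`. -/
def h (q k : ℕ) : SL2R := calT * g q k * calT⁻¹

/-- The denominator `c z + d`. -/
def den (a : SL2R) (z : ℂ) : ℂ := (a 1 0 : ℂ) * z + (a 1 1 : ℂ)

/-- The fractional linear action `a.z = (a z + b) / (c z + d)` at points where `c z + d ≠ 0`. -/
def moeb (a : SL2R) (z : ℂ) : ℂ := ((a 0 0 : ℂ) * z + (a 0 1 : ℂ)) / den a z

/-- `a.A ⊆ B` for subsets `A`, `B` of `ℂ` (in particular no point of `A` is sent to `∞`). -/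
def MapsInto (a : SL2R) (A B : Set ℂ) : Prop := ∀ z ∈ A, den a z ≠ 0 ∧ moeb a z ∈ B

/-- The automorphy factor `j_s(a, z) = ((c z + d) ^ (-2)) ^ s`, with the principal power. -/
def jfac (s : ℂ) (a : SL2R) (z : ℂ) : ℂ := ((den a z) ^ (-2 : ℤ)) ^ s

/-- `τ_s(a) f (z) = j_s(a⁻¹, z) f (a⁻¹.z)`. -/
def tau (s : ℂ) (a : SL2R) (f : ℂ → ℂ) (z : ℂ) : ℂ := jfac s a⁻¹ z * f (moeb a⁻¹ z)

/-! ## The domains -/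

/-- The three indices `1`, `r`, `q - 1`. -/
inductive Idx : Type
  | one : Idx
  | mid : Idx
  | last : Idx

instance : Fintype Idx :=
  ⟨⟨Multiset.ofList [Idx.one, Idx.mid, Idx.last], by simp⟩, by intro x; cases x <;> simp⟩

/-- The real intervals `E_1`, `E_r`, `E_{q-1}`, as subsets of `ℂ`. -/
def realInterval (q : ℕ) : Idx → Set ℂ
  | .one => (fun x : ℝ => (x : ℂ)) '' Ioo ((lam q - 1) / (lam q + 1)) 1
  | .mid => (fun x : ℝ => (x : ℂ)) ''
      Ioo (-((lam q - 1) / (lam q + 1))) ((lam q - 1) / (lam q + 1))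
  | .last => (fun x : ℝ => (x : ℂ)) '' Ioo (-1) (-((lam q - 1) / (lam q + 1)))

/-- The conditions on the complex neighbourhoods `ℰ_1`, `ℰ_r`, `ℰ_{q-1}` of the intervals. -/
structure Admissible (q : ℕ) (D : Idx → Set ℂ) : Prop where
  isOpen : ∀ j, IsOpen (D j)
  isConnected : ∀ j, IsConnected (D j)
  isBounded : ∀ j, Bornology.IsBounded (D j)
  closure_subset : ∀ j, closure (realInterval q j) ⊆ D j
  neg_mid : (fun z : ℂ => -z) '' D .mid = D .mid
  neg_one : (fun z : ℂ => -z) '' D .one = D .last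
  maps_hyp : ∀ k ∈ Finset.Icc 2 (q - 2), ∀ j, MapsInto (h q k)⁻¹ (closure (D j)) (D .mid)
  maps_one_mid : ∀ n : ℕ, 1 ≤ n → MapsInto ((h q 1)⁻¹ ^ n) (closure (D .mid)) (D .one)
  maps_one_last : ∀ n : ℕ, 1 ≤ n → MapsInto ((h q 1)⁻¹ ^ n) (closure (D .last)) (D .one)
  maps_last_one : ∀ n : ℕ, 1 ≤ n → MapsInto ((h q (q - 1))⁻¹ ^ n) (closure (D .one)) (D .last)
  maps_last_mid : ∀ n : ℕ, 1 ≤ n → MapsInto ((h q (q - 1))⁻¹ ^ n) (closure (D .mid)) (D .last)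
  re_one : ∀ z ∈ closure (D .one), -1 < z.re
  re_last : ∀ z ∈ closure (D .last), z.re < 1
  re_mid : ∀ z ∈ closure (D .mid), -1 < z.re ∧ z.re < 1
  /-- On the closures of the domains the principal power in `j_s(h_k⁻¹, ·)` does not meet the
  branch cut `(-∞, 0]`. -/
  branch : ∀ k ∈ Finset.Icc 2 (q - 2), ∀ j, ∀ z ∈ closure (D j),
    (den (h q k)⁻¹ z) ^ (-2 : ℤ) ∈ slitPlane

/-! ## The Banach spaces -/

/-- `B(Ω)`: continuous functions on the closure of `Ω` that are holomorphic in `Ω`, with the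
supremum norm. (For bounded `Ω` every continuous function on the closure is bounded.) -/
def BSpace (Ω : Set ℂ) : Submodule ℂ (closure Ω →ᵇ ℂ) where
  carrier := {F | ∃ φ : ℂ → ℂ, DifferentiableOn ℂ φ Ω ∧
    ∀ (z : ℂ) (hz : z ∈ Ω), F ⟨z, subset_closure hz⟩ = φ z}
  zero_mem' := ⟨fun _ => 0, differentiableOn_const 0, fun _ _ => rfl⟩
  add_mem' := by
    rintro F G ⟨φ, hφ, h1⟩ ⟨ψ, hψ, h2⟩
    exact ⟨fun z => φ z + ψ z, hφ.add hψ, fun z hz => by simp [h1 z hz, h2 z hz]⟩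
  smul_mem' := by
    rintro c F ⟨φ, hφ, h1⟩
    exact ⟨fun z => c * φ z, hφ.const_mul c, fun z hz => by simp [h1 z hz]⟩

open Classical in
/-- The values of an element of `B(Ω)`, as a function on `ℂ` (extended by `0` off the closure). -/
def val {Ω : Set ℂ} (F : BSpace Ω) (z : ℂ) : ℂ :=
  if hz : z ∈ closure Ω then (F : closure Ω →ᵇ ℂ) ⟨z, hz⟩ else 0

/-- `B(ℰ) = B(ℰ_1) × B(ℰ_r) × B(ℰ_{q-1})`. -/
abbrev BProd (D : Idx → Set ℂ) : Type := ∀ j : Idx, BSpace (D j)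

/-! ## The transfer operator -/

/-- `∑_{k=2}^{q-2} τ_s(h_k) f`. -/
def hypSum (q : ℕ) (s : ℂ) (f : ℂ → ℂ) (z : ℂ) : ℂ :=
  ∑ k ∈ Finset.Icc 2 (q - 2), tau s (h q k) f z

/-- The `n`-th term `τ_s(a ^ n) f (z)`, `n ≥ 1`, with index shifted to start at `0`. -/
def parTerm (s : ℂ) (a : SL2R) (f : ℂ → ℂ) (z : ℂ) (n : ℕ) : ℂ := tau s (a ^ (n + 1)) f z

/-- The components of `ℒ_{H,s} f`, for `f = (f_1, f_r, f_{q-1})`. -/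
def transfer (q : ℕ) (s : ℂ) (f : Idx → ℂ → ℂ) : Idx → ℂ → ℂ
  | .one => fun z => hypSum q s (f .mid) z + ∑' n, parTerm s (h q (q - 1)) (f .last) z n
  | .mid => fun z => (∑' n, parTerm s (h q 1) (f .one) z n) + hypSum q s (f .mid) z +
      ∑' n, parTerm s (h q (q - 1)) (f .last) z n
  | .last => fun z => (∑' n, parTerm s (h q 1) (f .one) z n) + hypSum q s (f .mid) z

/-- Convergence of the series that occur in the components of `ℒ_{H,s} f`. -/
def TransferConverges (q : ℕ) (s : ℂ) (f : Idx → ℂ → ℂ) : Idx → ℂ → Prop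
  | .one => fun z => Summable (parTerm s (h q (q - 1)) (f .last) z)
  | .mid => fun z => Summable (parTerm s (h q 1) (f .one) z) ∧
      Summable (parTerm s (h q (q - 1)) (f .last) z)
  | .last => fun z => Summable (parTerm s (h q 1) (f .one) z)

/-- The bounded operator `L` on `B(ℰ)` is the transfer operator `ℒ_{H,s}`. -/
def IsTransferOperator (q : ℕ) (D : Idx → Set ℂ) (s : ℂ) (L : BProd D →L[ℂ] BProd D) : Prop :=
  ∀ f : BProd D, ∀ j, ∀ z ∈ D j,
    TransferConverges q s (fun i => val (f i)) j z ∧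
      val (L f j) z = transfer q s (fun i => val (f i)) j z

/-! ## Nuclear operators of order `0` and meromorphic families -/

/-- `L` is nuclear of order `0`: for every `0 < p ≤ 1` it has a representation
`L = ∑ c_n φ_n ⊗ y_n` with `‖φ_n‖ ≤ 1`, `‖y_n‖ ≤ 1` and `∑ |c_n| ^ p < ∞`. -/
def IsNuclearOfOrderZero {X Y : Type*} [NormedAddCommGroup X] [NormedSpace ℂ X]
    [NormedAddCommGroup Y] [NormedSpace ℂ Y] (L : X →L[ℂ] Y) : Prop :=
  ∀ p : ℝ, 0 < p → p ≤ 1 →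
    ∃ (c : ℕ → ℂ) (φ : ℕ → X →L[ℂ] ℂ) (y : ℕ → Y),
      (∀ n, ‖φ n‖ ≤ 1) ∧ (∀ n, ‖y n‖ ≤ 1) ∧ Summable (fun n => ‖c n‖ ^ p) ∧
        ∀ x, HasSum (fun n => (c n * φ n x) • y n) (L x)

/-- A family of operators on `B(ℰ)` is meromorphic on `ℂ` with values in nuclear operators of
order `0` and poles in `P`. The values of the family at points of `P` are irrelevant. -/
structure IsMeromorphicNuclearFamily (D : Idx → Set ℂ) (P : Set ℂ)
    (L : ℂ → BProd D →L[ℂ] BProd D) : Prop where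
  isClosed : IsClosed P
  discrete : IsDiscrete P
  nuclear : ∀ s ∉ P, IsNuclearOfOrderZero (L s)
  meromorphic : ∀ f : BProd D, ∀ j, ∀ z ∈ D j, ∀ s, MeromorphicAt (fun w => val (L w f j) z) s
  holomorphic : ∀ f : BProd D, ∀ j, ∀ z ∈ D j, DifferentiableOn ℂ (fun w => val (L w f j) z) Pᶜ
  continuous : ∀ f : BProd D, ∀ j,
    ContinuousOn (fun p : ℂ × ℂ => val (L p.1 f j) p.2) (Pᶜ ×ˢ D j)

/-- The set of possible poles `(1 - k) / 2`, `k = 0, 1, 2, …`. -/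
def poleSet : Set ℂ := {s | ∃ k : ℕ, s = (1 - (k : ℂ)) / 2}

end HeckeTransfer

end

/-! The elements h_1 and h_{q-1} are parabolic with fixed points σ = 1 and σ = -1. Put c = λ/2 and
x(z) = 1/(c(1 - σz)). The n-th powers of their inverses act in this coordinate as x ↦ x + n. With a
= 2s, p = σ and e = -σ/c, each parabolic sum becomes x^a P_a f, where P_a f = ∑_{n ≥ 1} (n + x)^{-a}
f(p + e/(n + x)). The half-plane conditions on the domains give Re x > 0, so P_a converges in
operator norm for Re a > 1.

The continuation rests on a single Taylor step (`parSum_eq_add`). Let G f = e (f - f(p))/(· - p).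
Then f(p + eu) = f(p) + u (G f)(p + eu), and u = 1/(n + x) gives P_a = ζ(a, x) ⊗ δ_p + P_{a+1} G,
with ζ(a, x) = ∑_{n ≥ 1} (n + x)^{-a} taken in the target Banach space. Iterating N times continues
P_a to Re a > 1 - N. The k-th split term is ((a + k - 1) ζ(a + k, x)) ⊗ (δ_p ∘ G^k) divided by a + k
- 1, that is, a rank one family with a simple pole at a = 1 - k
(`exists_simplePoleFamily_of_shift`).

This needs (a - 1) ζ(a, x) to be entire with values in B(Ω'). The same Taylor step gives it, applied
to (1 + v)^{1-a} on a disc about 0 of radius less than 1, with p = 0 and e = -1. The sum then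
telescopes to x^{1-a}, while the expansion expresses (a - 1) ζ(a, x) through (a + j) - 1 times ζ(a +
j, x) with j ≥ 1 and a holomorphic remainder (`zetaSum_recursion`).

Nuclearity for Re a > 1 comes from the fact that all points p + e/(n + x(z)) lie in one compact
subset of Ω. An operator controlled by the supremum over such a set is exponentially small on
functions with many vanishing Taylor coefficients at finitely many centres
(`isNuclearOfOrderZero_of_compact`). Such an operator is a telescoping sum of finite rank pieces
whose norms decay geometrically up to polynomial factors (`isNuclearOfOrderZero_of_vanishing`).
Finite rank terms and composition preserve nuclearity, so it persists under continuation.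

The remaining terms, with 2 ≤ k ≤ q - 2, are entire in s and nuclear by the same criterion. The
operator has exactly four parabolic blocks, each with a rank one polar part; this is the bound 4. -/

noncomputable section

namespace HeckeTransfer

/-! ## The Banach spaces `B(Ω)` -/

/-- Bounded open subsets of the plane. -/
class IsBoundedOpen (Ω : Set ℂ) : Prop where
  isOpen : IsOpen Ω
  isBounded : Bornology.IsBounded Ω

theorem isCompact_closure_of_isBoundedOpen (Ω : Set ℂ) [h : IsBoundedOpen Ω] :
    IsCompact (closure Ω) := h.isBounded.isCompact_closure

section Val

variable {Ω : Set ℂ}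

theorem val_of_mem (F : BSpace Ω) {z : ℂ} (hz : z ∈ closure Ω) :
    val F z = (F : closure Ω →ᵇ ℂ) ⟨z, hz⟩ := dif_pos hz

theorem norm_val_le (F : BSpace Ω) (z : ℂ) : ‖val F z‖ ≤ ‖F‖ := by
  by_cases hz : z ∈ closure Ω
  · rw [val_of_mem F hz]
    exact (F : closure Ω →ᵇ ℂ).norm_coe_le_norm _
  · rw [val, dif_neg hz, norm_zero]
    exact norm_nonneg F

theorem val_add (F G : BSpace Ω) (z : ℂ) : val (F + G) z = val F z + val G z := by
  by_cases hz : z ∈ closure Ω <;> simp [val, hz]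

theorem val_smul (c : ℂ) (F : BSpace Ω) (z : ℂ) : val (c • F) z = c * val F z := by
  by_cases hz : z ∈ closure Ω <;> simp [val, hz]

theorem norm_le_of_val {F : BSpace Ω} {C : ℝ} (hC : 0 ≤ C)
    (h : ∀ z ∈ closure Ω, ‖val F z‖ ≤ C) : ‖F‖ ≤ C := by
  refine (BoundedContinuousFunction.norm_le (f := (F : closure Ω →ᵇ ℂ)) hC).2 fun z => ?_
  have := h z z.2
  rwa [val_of_mem F z.2] at this

theorem ext_val {F G : BSpace Ω} (h : ∀ z ∈ closure Ω, val F z = val G z) : F = G := by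
  apply Subtype.ext
  ext z
  have := h z z.2
  rwa [val_of_mem F z.2, val_of_mem G z.2] at this

theorem continuousOn_val (F : BSpace Ω) : ContinuousOn (val F) (closure Ω) := by
  rw [continuousOn_iff_continuous_domRestrict]
  convert (F : closure Ω →ᵇ ℂ).continuous using 1
  ext z
  exact val_of_mem F z.2

theorem differentiableOn_val (F : BSpace Ω) : DifferentiableOn ℂ (val F) Ω := by
  obtain ⟨φ, hφ, h⟩ := F.2
  refine hφ.congr fun z hz => ?_
  rw [val_of_mem F (subset_closure hz), h z hz]

/-- Evaluation at a point, as a continuous functional. -/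
def evalCLM (Ω : Set ℂ) (z : ℂ) : BSpace Ω →L[ℂ] ℂ :=
  LinearMap.mkContinuous
    { toFun := fun F => val F z
      map_add' := fun F G => val_add F G z
      map_smul' := fun c F => val_smul c F z } 1
    fun F => by
      rw [one_mul]
      exact norm_val_le F z

theorem val_sub (F G : BSpace Ω) (z : ℂ) : val (F - G) z = val F z - val G z :=
  map_sub (evalCLM Ω z) F G

theorem val_sum {ι : Type*} (t : Finset ι) (F : ι → BSpace Ω) (z : ℂ) :
    val (∑ i ∈ t, F i) z = ∑ i ∈ t, val (F i) z :=
  map_sum (evalCLM Ω z) F t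

section OfFun

variable [IsBoundedOpen Ω]

/-- The element of `B(Ω)` given by a function that is continuous on the closure of `Ω` and
holomorphic in `Ω`. -/
def ofFun (φ : ℂ → ℂ) (hc : ContinuousOn φ (closure Ω)) (hd : DifferentiableOn ℂ φ Ω) :
    BSpace Ω :=
  haveI : CompactSpace (closure Ω) :=
    isCompact_iff_compactSpace.1 (isCompact_closure_of_isBoundedOpen Ω)
  ⟨BoundedContinuousFunction.mkOfCompact
      ⟨(closure Ω).domRestrict φ, continuousOn_iff_continuous_domRestrict.1 hc⟩,
    φ, hd, fun _ _ => rfl⟩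

theorem val_ofFun {φ : ℂ → ℂ} (hc : ContinuousOn φ (closure Ω)) (hd : DifferentiableOn ℂ φ Ω)
    {z : ℂ} (hz : z ∈ closure Ω) : val (ofFun φ hc hd) z = φ z := by
  rw [val_of_mem _ hz]
  rfl

/-- Locally uniform limits of holomorphic functions are holomorphic. Completeness follows, and with
it the convergence of absolutely summable series of operators. -/
theorem isClosed_bSpace : IsClosed (BSpace Ω : Set (closure Ω →ᵇ ℂ)) := by
  refine isClosed_of_closure_subset fun F hF => ?_
  obtain ⟨u, hu, hlim⟩ := mem_closure_iff_seq_limit.1 hF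
  let w : ℕ → BSpace Ω := fun n => ⟨u n, hu n⟩
  classical
  let φ : ℂ → ℂ := fun z => if hz : z ∈ closure Ω then F ⟨z, hz⟩ else 0
  have hφ : ∀ z (hz : z ∈ closure Ω), φ z = F ⟨z, hz⟩ := fun z hz => dif_pos hz
  have hunif : TendstoUniformlyOn (fun n => val (w n)) φ atTop Ω := by
    rw [Metric.tendstoUniformlyOn_iff]
    intro ε hε
    filter_upwards [Metric.tendsto_nhds.1 hlim ε hε] with n hn z hz
    rw [hφ z (subset_closure hz), val_of_mem (w n) (subset_closure hz), dist_comm]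
    exact (BoundedContinuousFunction.dist_coe_le_dist _).trans_lt hn
  refine ⟨φ, ?_, fun z hz => (hφ z (subset_closure hz)).symm⟩
  exact hunif.tendstoLocallyUniformlyOn.differentiableOn
    (Eventually.of_forall fun n => differentiableOn_val (w n)) (IsBoundedOpen.isOpen (Ω := Ω))

instance : CompleteSpace (BSpace Ω) := (isClosed_bSpace (Ω := Ω)).completeSpace_coe

end OfFun

/-- The pointwise product in `B(Ω)`. -/
def mulElem (F G : BSpace Ω) : BSpace Ω :=
  ⟨(F : closure Ω →ᵇ ℂ) * (G : closure Ω →ᵇ ℂ), fun z => val F z * val G z,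
    (differentiableOn_val F).mul (differentiableOn_val G), fun z hz => by
      simp [val_of_mem _ (subset_closure hz)]⟩

theorem val_mulElem (F G : BSpace Ω) (z : ℂ) : val (mulElem F G) z = val F z * val G z := by
  by_cases hz : z ∈ closure Ω
  · simp only [val_of_mem _ hz]
    rfl
  · simp [val, hz]

/-- Multiplication in `B(Ω)`, as a continuous bilinear map. -/
def mulB (Ω : Set ℂ) : BSpace Ω →L[ℂ] BSpace Ω →L[ℂ] BSpace Ω :=
  LinearMap.mkContinuous₂
    (LinearMap.mk₂ ℂ mulElem
      (fun F G H => ext_val fun z _ => by simp only [val_mulElem, val_add]; ring)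
      (fun c F G => ext_val fun z _ => by simp only [val_mulElem, val_smul]; ring)
      (fun F G H => ext_val fun z _ => by simp only [val_mulElem, val_add]; ring)
      (fun c F G => ext_val fun z _ => by simp only [val_mulElem, val_smul]; ring)) 1
    fun F G => norm_le_of_val (by positivity) fun z _ => by
      simp only [LinearMap.mk₂_apply, val_mulElem, norm_mul, one_mul]
      exact mul_le_mul (norm_val_le F z) (norm_val_le G z) (norm_nonneg _) (norm_nonneg _)

@[simp] theorem val_mulB (F G : BSpace Ω) (z : ℂ) :
    val (mulB Ω F G) z = val F z * val G z := val_mulElem F G z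

theorem norm_mulB_le (F : BSpace Ω) : ‖mulB Ω F‖ ≤ ‖F‖ :=
  ContinuousLinearMap.opNorm_le_bound _ (norm_nonneg F) fun G =>
    norm_le_of_val (by positivity) fun z _ => by
      rw [val_mulB, norm_mul]
      exact mul_le_mul (norm_val_le F z) (norm_val_le G z) (norm_nonneg _) (norm_nonneg _)

/-! ### Exponentials -/

/-- The norm is the restricted one, so difference quotients agree. Derivatives can therefore be
computed in the ambient Banach algebra. -/
theorem hasDerivAt_bSpace {u : ℂ → BSpace Ω} {u' : BSpace Ω} {a : ℂ}
    (h : HasDerivAt (fun s => (u s : closure Ω →ᵇ ℂ)) (u' : closure Ω →ᵇ ℂ) a) :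
    HasDerivAt u u' a := by
  rw [hasDerivAt_iff_tendsto] at h ⊢
  exact h

variable [IsBoundedOpen Ω]

/-- The function `z ↦ exp (a g(z))`. -/
def expB (g : BSpace Ω) (a : ℂ) : BSpace Ω :=
  ofFun (fun z => exp (a * val g z)) ((continuousOn_const.mul (continuousOn_val g)).cexp)
    (((differentiableOn_val g).const_mul a).cexp)

theorem val_expB (g : BSpace Ω) (a : ℂ) {z : ℂ} (hz : z ∈ closure Ω) :
    val (expB g a) z = exp (a * val g z) := val_ofFun _ _ hz

/-- Point evaluation is a continuous ring homomorphism, hence commutes with the exponential series.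
This gives norm holomorphy in `a` from the Banach algebra exponential. -/
theorem coe_expB (g : BSpace Ω) (a : ℂ) :
    (expB g a : closure Ω →ᵇ ℂ) = NormedSpace.exp (a • (g : closure Ω →ᵇ ℂ)) := by
  ext z
  let ev : (closure Ω →ᵇ ℂ) →+* ℂ :=
    { toFun := fun F => F z
      map_one' := rfl
      map_mul' := fun _ _ => rfl
      map_zero' := rfl
      map_add' := fun _ _ => rfl }
  have hev : Continuous ev := continuous_eval_const z
  have h1 := NormedSpace.map_exp (f := ev) hev (a • (g : closure Ω →ᵇ ℂ))
  have h2 := val_expB g a z.2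
  rw [val_of_mem _ z.2, val_of_mem _ z.2] at h2
  change (expB g a : closure Ω →ᵇ ℂ) z = ev _
  rw [h1, h2, ← Complex.exp_eq_exp_ℂ]
  rfl

theorem differentiable_expB (g : BSpace Ω) : Differentiable ℂ (expB g) := fun a => by
  have h := hasDerivAt_exp_smul_const (𝕂 := ℂ) (g : closure Ω →ᵇ ℂ) a
  have h' : HasDerivAt (fun s => (expB g s : closure Ω →ᵇ ℂ))
      ((mulB Ω (expB g a) g : BSpace Ω) : closure Ω →ᵇ ℂ) a := by
    simp only [coe_expB]
    convert! h using 1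
    rw [← coe_expB]
    rfl
  exact (hasDerivAt_bSpace h').differentiableAt

end Val

/-! ### Operators given by pointwise formulas -/

section Operators

variable {Ω Ω' : Set ℂ} [IsBoundedOpen Ω']

/-- The composition operator `f ↦ f ∘ ψ`. -/
def compOp (ψ : ℂ → ℂ) (hm : MapsTo ψ (closure Ω') Ω) (hc : ContinuousOn ψ (closure Ω'))
    (hd : DifferentiableOn ℂ ψ Ω') : BSpace Ω →L[ℂ] BSpace Ω' :=
  LinearMap.mkContinuous
    { toFun := fun f => ofFun (fun z => val f (ψ z))
        ((continuousOn_val f).comp hc (hm.mono_right subset_closure))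
        ((differentiableOn_val f).comp hd (hm.mono_left subset_closure))
      map_add' := fun f g => ext_val fun z hz => by
        simp only [val_add, val_ofFun _ _ hz]
      map_smul' := fun c f => ext_val fun z hz => by
        simp only [val_smul, val_ofFun _ _ hz, RingHom.id_apply] } 1
    fun f => norm_le_of_val (by positivity) fun z hz => by
      simp only [LinearMap.coe_mk, AddHom.coe_mk, val_ofFun _ _ hz, one_mul]
      exact norm_val_le f _

theorem val_compOp {ψ : ℂ → ℂ} (hm : MapsTo ψ (closure Ω') Ω)
    (hc : ContinuousOn ψ (closure Ω')) (hd : DifferentiableOn ℂ ψ Ω') (f : BSpace Ω) {z : ℂ}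
    (hz : z ∈ closure Ω') : val (compOp ψ hm hc hd f) z = val f (ψ z) :=
  val_ofFun ((continuousOn_val f).comp hc (hm.mono_right subset_closure))
    ((differentiableOn_val f).comp hd (hm.mono_left subset_closure)) hz

theorem norm_compOp_le {ψ : ℂ → ℂ} (hm : MapsTo ψ (closure Ω') Ω)
    (hc : ContinuousOn ψ (closure Ω')) (hd : DifferentiableOn ℂ ψ Ω') :
    ‖compOp ψ hm hc hd‖ ≤ 1 := LinearMap.mkContinuous_norm_le _ zero_le_one _

end Operators

/-! ### The shift on Taylor coefficients -/

section Shift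

variable {Ω : Set ℂ}

/-- The Schwarz lemma gives the bound inside the disc; outside it the denominator is at least R. -/
theorem norm_dslope_val_le (f : BSpace Ω) {p : ℂ} {R : ℝ} (hR : 0 < R)
    (hb : Metric.ball p R ⊆ Ω) (z : ℂ) :
    ‖dslope (val f) p z‖ ≤ 2 / R * ‖f‖ := by
  have key : ∀ w, ‖val f w - val f p‖ ≤ 2 * ‖f‖ := fun w =>
    (norm_sub_le _ _).trans (by linarith [norm_val_le f w, norm_val_le f p])
  by_cases hz : z ∈ Metric.ball p R
  · refine (norm_dslope_le_div_of_mapsTo_ball (R₂ := 2 * ‖f‖)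
      ((differentiableOn_val f).mono hb) (fun w _ => ?_) hz).trans_eq (by ring)
    rw [Metric.mem_closedBall, dist_eq_norm]
    exact key w
  · have hz' : R ≤ ‖z - p‖ := by
      rw [Metric.mem_ball, dist_eq_norm] at hz
      exact not_lt.1 hz
    have hne : z ≠ p := by
      rintro rfl
      simp at hz'
      linarith
    rw [dslope_of_ne _ hne, slope_def_field, norm_div, div_mul_eq_mul_div]
    exact div_le_div₀ (by positivity) (key z) hR hz'

variable [IsBoundedOpen Ω]

/-- The operator `f ↦ e (f - f(p)) / (· - p)`, the shift on Taylor coefficients at `p` with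
respect to the coordinate `u`, `z = p + e u`. -/
def shiftOp {p : ℂ} (hp : p ∈ Ω) (e : ℂ) : BSpace Ω →L[ℂ] BSpace Ω :=
  have hn : Ω ∈ 𝓝 p := (IsBoundedOpen.isOpen (Ω := Ω)).mem_nhds hp
  LinearMap.mkContinuousOfExistsBound
    { toFun := fun f => ofFun (fun z => e * dslope (val f) p z)
        (continuousOn_const.mul ((continuousOn_dslope (mem_of_superset hn subset_closure)).2
          ⟨continuousOn_val f, (differentiableOn_val f).differentiableAt hn⟩))
        (((differentiableOn_dslope hn).2 (differentiableOn_val f)).const_mul e)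
      map_add' := fun f g => ext_val fun z hz => by
        simp only [val_add, val_ofFun _ _ hz]
        rw [← mul_add]
        congr 1
        have hf := (differentiableOn_val f).differentiableAt hn
        have hg := (differentiableOn_val g).differentiableAt hn
        have h : val (f + g) = val f + val g := funext fun w => val_add f g w
        rw [h]
        by_cases hzp : z = p
        · subst hzp
          simp [dslope_same, deriv_add hf hg]
        · simp only [dslope_of_ne _ hzp, slope_def_field, Pi.add_apply]
          ring
      map_smul' := fun c f => ext_val fun z hz => by
        simp only [val_smul, val_ofFun _ _ hz, RingHom.id_apply]
        rw [mul_left_comm]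
        congr 1
        have h : val (c • f) = fun w => c * val f w := funext fun w => val_smul c f w
        rw [h]
        by_cases hzp : z = p
        · subst hzp
          simp [dslope_same, deriv_const_mul_field]
        · simp only [dslope_of_ne _ hzp, slope_def_field]
          ring }
    (by
      obtain ⟨R, hR, hball⟩ := Metric.mem_nhds_iff.1 hn
      refine ⟨‖e‖ * (2 / R), fun f => norm_le_of_val (by positivity) fun z hz => ?_⟩
      simp only [LinearMap.coe_mk, AddHom.coe_mk, val_ofFun _ _ hz, norm_mul, mul_assoc]
      exact mul_le_mul_of_nonneg_left (norm_dslope_val_le f hR hball z) (norm_nonneg e))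

variable {p : ℂ} (hp : p ∈ Ω) (e : ℂ)

theorem val_shiftOp (f : BSpace Ω) {z : ℂ} (hz : z ∈ closure Ω) :
    val (shiftOp hp e f) z = e * dslope (val f) p z :=
  have hn : Ω ∈ 𝓝 p := (IsBoundedOpen.isOpen (Ω := Ω)).mem_nhds hp
  val_ofFun (continuousOn_const.mul
      ((continuousOn_dslope (mem_of_superset hn subset_closure)).2
        ⟨continuousOn_val f, (differentiableOn_val f).differentiableAt hn⟩))
    (((differentiableOn_dslope hn).2 (differentiableOn_val f)).const_mul e) hz

theorem norm_shiftOp_le {R : ℝ} (hR : 0 < R) (hball : Metric.ball p R ⊆ Ω) (f : BSpace Ω) :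
    ‖shiftOp hp e f‖ ≤ ‖e‖ * (2 / R) * ‖f‖ :=
  norm_le_of_val (by positivity) fun z hz => by
    rw [val_shiftOp hp e f hz, norm_mul, mul_assoc]
    exact mul_le_mul_of_nonneg_left (norm_dslope_val_le f hR hball z) (norm_nonneg e)

/-- The factor e in the shift makes u itself the multiplier. At u = 1/(n + x) it raises the exponent
in a parabolic sum by one. -/
theorem val_eq_add_shiftOp (f : BSpace Ω) {u : ℂ} (hz : p + e * u ∈ closure Ω) :
    val f (p + e * u) = val f p + u * val (shiftOp hp e f) (p + e * u) := by
  have h := sub_smul_dslope (val f) p (p + e * u)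
  rw [smul_eq_mul] at h
  rw [val_shiftOp hp e f hz]
  linear_combination -h

end Shift

/-! ## Nuclear operators of order zero -/

section Nuclear

variable {X Y Z : Type*} [NormedAddCommGroup X] [NormedSpace ℂ X]
  [NormedAddCommGroup Y] [NormedSpace ℂ Y] [NormedAddCommGroup Z] [NormedSpace ℂ Z]

/-- The norms of `φ i` and `y i` are moved into the coefficient, and an injection into ℕ pads by
zeros. Later proofs may thus use any countable index set without normalising. -/
theorem isNuclearOfOrderZero_of_hasSum {L : X →L[ℂ] Y}
    (h : ∀ p : ℝ, 0 < p → p ≤ 1 → ∃ (ι : Type) (_ : Countable ι) (φ : ι → X →L[ℂ] ℂ) (y : ι → Y),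
      Summable (fun i => (‖φ i‖ * ‖y i‖) ^ p) ∧ ∀ x, HasSum (fun i => φ i x • y i) (L x)) :
    IsNuclearOfOrderZero L := by
  intro p hp hp1
  obtain ⟨ι, _, φ, y, hs, hL⟩ := h p hp hp1
  obtain ⟨enc, henc⟩ := exists_injective_nat ι
  have hnorm1 : ∀ i, ‖((‖φ i‖⁻¹ : ℝ) : ℂ) • φ i‖ ≤ 1 := fun i => by
    rw [norm_smul, norm_real, norm_inv, norm_norm]
    exact inv_mul_le_one
  have hnorm2 : ∀ i, ‖((‖y i‖⁻¹ : ℝ) : ℂ) • y i‖ ≤ 1 := fun i => by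
    rw [norm_smul, norm_real, norm_inv, norm_norm]
    exact inv_mul_le_one
  let c : ι → ℂ := fun i => ((‖φ i‖ * ‖y i‖ : ℝ) : ℂ)
  refine ⟨Function.extend enc c 0,
    Function.extend enc (fun i => ((‖φ i‖⁻¹ : ℝ) : ℂ) • φ i) 0,
    Function.extend enc (fun i => ((‖y i‖⁻¹ : ℝ) : ℂ) • y i) 0, ?_, ?_, ?_, ?_⟩
  · intro n
    by_cases hn : ∃ i, enc i = n
    · obtain ⟨i, rfl⟩ := hn
      rw [henc.extend_apply]
      exact hnorm1 i
    · rw [Function.extend_apply' _ _ _ hn]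
      simp
  · intro n
    by_cases hn : ∃ i, enc i = n
    · obtain ⟨i, rfl⟩ := hn
      rw [henc.extend_apply]
      exact hnorm2 i
    · rw [Function.extend_apply' _ _ _ hn]
      simp
  · rw [← summable_extend_zero henc] at hs
    convert! hs using 1
    ext n
    by_cases hn : ∃ i, enc i = n
    · obtain ⟨i, rfl⟩ := hn
      rw [henc.extend_apply, henc.extend_apply, norm_real, Real.norm_of_nonneg (by positivity)]
    · rw [Function.extend_apply' _ _ _ hn, Function.extend_apply' _ _ _ hn]
      simp [Real.zero_rpow hp.ne']
  · intro x
    have hx := hL x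
    rw [← hasSum_extend_zero henc] at hx
    convert! hx using 1
    ext n
    by_cases hn : ∃ i, enc i = n
    · obtain ⟨i, rfl⟩ := hn
      rw [henc.extend_apply, henc.extend_apply, henc.extend_apply, henc.extend_apply]
      -- The convention 0⁻¹ = 0 makes the normalised vectors harmless when a norm vanishes; these
      -- cases contribute zero on both sides.
      rcases eq_or_ne (φ i) 0 with h0 | h0
      · simp [h0]
      rcases eq_or_ne (y i) 0 with h1 | h1
      · simp [h1]
      have h0' : ((‖φ i‖ : ℝ) : ℂ) ≠ 0 := by simpa using h0
      have h1' : ((‖y i‖ : ℝ) : ℂ) ≠ 0 := by simpa using h1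
      simp only [c, smul_smul, FunLike.coe_smul, Pi.smul_apply, smul_eq_mul]
      congr 1
      push_cast
      field_simp
    · simp [Function.extend_apply' _ _ _ hn]

theorem IsNuclearOfOrderZero.exists_hasSum {L : X →L[ℂ] Y} (h : IsNuclearOfOrderZero L) {p : ℝ}
    (hp : 0 < p) (hp1 : p ≤ 1) : ∃ (φ : ℕ → X →L[ℂ] ℂ) (y : ℕ → Y),
      Summable (fun i => (‖φ i‖ * ‖y i‖) ^ p) ∧ ∀ x, HasSum (fun i => φ i x • y i) (L x) := by
  obtain ⟨c, φ, y, hφ, hy, hc, hL⟩ := h p hp hp1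
  refine ⟨fun n => c n • φ n, y, ?_, fun x => by simpa using hL x⟩
  refine hc.of_nonneg_of_le (fun n => by positivity) fun n => ?_
  refine Real.rpow_le_rpow (by positivity) ?_ hp.le
  rw [norm_smul, mul_assoc]
  exact mul_le_of_le_one_right (norm_nonneg _)
    (mul_le_one₀ (hφ n) (norm_nonneg _) (hy n))

theorem isNuclearOfOrderZero_zero : IsNuclearOfOrderZero (0 : X →L[ℂ] Y) :=
  isNuclearOfOrderZero_of_hasSum fun p hp _ => ⟨ℕ, inferInstance, 0, 0, by
    simp [Real.zero_rpow hp.ne'], fun x => by simp⟩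

theorem IsNuclearOfOrderZero.add {L M : X →L[ℂ] Y} (hL : IsNuclearOfOrderZero L)
    (hM : IsNuclearOfOrderZero M) : IsNuclearOfOrderZero (L + M) :=
  isNuclearOfOrderZero_of_hasSum fun p hp hp1 => by
    obtain ⟨φ, y, h1, h2⟩ := hL.exists_hasSum hp hp1
    obtain ⟨ψ, w, h3, h4⟩ := hM.exists_hasSum hp hp1
    refine ⟨ℕ ⊕ ℕ, inferInstance, Sum.elim φ ψ, Sum.elim y w, ?_, fun x => ?_⟩
    · exact Summable.sum (f := fun i => (‖Sum.elim φ ψ i‖ * ‖Sum.elim y w i‖) ^ p) h1 h3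
    · exact HasSum.sum (f := fun i => Sum.elim φ ψ i x • Sum.elim y w i) (h2 x) (h4 x)

theorem IsNuclearOfOrderZero.sum {ι : Type*} (t : Finset ι) {L : ι → X →L[ℂ] Y}
    (h : ∀ i ∈ t, IsNuclearOfOrderZero (L i)) : IsNuclearOfOrderZero (∑ i ∈ t, L i) :=
  Finset.sum_induction L IsNuclearOfOrderZero (fun _ _ => IsNuclearOfOrderZero.add)
    isNuclearOfOrderZero_zero h

theorem summable_rpow_const_mul {u v : ℕ → ℝ} {C p : ℝ} (hp : 0 < p) (hC : 0 ≤ C)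
    (hu : ∀ n, 0 ≤ u n) (hv : ∀ n, 0 ≤ v n) (h : ∀ n, v n ≤ C * u n)
    (hs : Summable fun n => u n ^ p) : Summable fun n => v n ^ p := by
  refine (hs.mul_left (C ^ p)).of_nonneg_of_le (fun n => Real.rpow_nonneg (hv n) p) fun n => ?_
  rw [← Real.mul_rpow hC (hu n)]
  exact Real.rpow_le_rpow (hv n) (h n) hp.le

theorem IsNuclearOfOrderZero.comp_left {L : X →L[ℂ] Y} (hL : IsNuclearOfOrderZero L)
    (M : Y →L[ℂ] Z) : IsNuclearOfOrderZero (M.comp L) :=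
  isNuclearOfOrderZero_of_hasSum fun p hp hp1 => by
    obtain ⟨φ, y, h1, h2⟩ := hL.exists_hasSum hp hp1
    refine ⟨ℕ, inferInstance, φ, fun n => M (y n), ?_, fun x => ?_⟩
    · refine summable_rpow_const_mul hp (norm_nonneg M) (fun n => by positivity)
        (fun n => by positivity) (fun n => ?_) h1
      rw [mul_left_comm]
      exact mul_le_mul_of_nonneg_left (M.le_opNorm _) (norm_nonneg _)
    · simpa using (h2 x).mapL M

theorem IsNuclearOfOrderZero.comp_right {L : Y →L[ℂ] Z} (hL : IsNuclearOfOrderZero L)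
    (M : X →L[ℂ] Y) : IsNuclearOfOrderZero (L.comp M) :=
  isNuclearOfOrderZero_of_hasSum fun p hp hp1 => by
    obtain ⟨φ, y, h1, h2⟩ := hL.exists_hasSum hp hp1
    refine ⟨ℕ, inferInstance, fun n => (φ n).comp M, y, ?_, fun x => by simpa using h2 (M x)⟩
    refine summable_rpow_const_mul hp (norm_nonneg M) (fun n => by positivity)
        (fun n => by positivity) (fun n => ?_) h1
    rw [← mul_assoc, mul_comm ‖M‖]
    exact mul_le_mul_of_nonneg_right ((φ n).opNorm_comp_le M) (norm_nonneg _)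

theorem isNuclearOfOrderZero_smulRight (φ : X →L[ℂ] ℂ) (y : Y) :
    IsNuclearOfOrderZero (φ.smulRight y) :=
  isNuclearOfOrderZero_of_hasSum fun p hp _ => ⟨Unit, inferInstance, fun _ => φ, fun _ => y,
    (hasSum_unique _).summable, fun x => by
      simp⟩

theorem IsNuclearOfOrderZero.const_smul {L : X →L[ℂ] Y} (hL : IsNuclearOfOrderZero L) (c : ℂ) :
    IsNuclearOfOrderZero (c • L) := by
  have := hL.comp_left (c • ContinuousLinearMap.id ℂ Y)
  rwa [ContinuousLinearMap.smul_comp, ContinuousLinearMap.id_comp] at this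

/-! ### Bounded projections along the common kernel of finitely many functionals -/

/-- For a surjective map to `ℂ^k` there are almost biorthogonal systems with norms
bounded independently of `k`. -/
theorem exists_biorthogonal_of_surjective {k : ℕ} (Λ : X →L[ℂ] (Fin k → ℂ))
    (hΛ : Function.Surjective Λ) :
    ∃ (x : Fin k → X) (φ : Fin k → X →L[ℂ] ℂ), (∀ j, ‖x j‖ ≤ 1) ∧ (∀ j, ‖φ j‖ ≤ 2) ∧
      (∀ v, Λ (v - ∑ j, φ j v • x j) = 0) ∧ ∀ v, Λ v = 0 → ∀ j, φ j v = 0 := by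
  classical
  -- Auerbach's argument: nearly maximise the determinant over k-tuples in the unit ball. The
  -- supremum need not be attained, so a tuple above half of it is used; this is the origin of the
  -- bound 2.
  let M : (Fin k → X) → Matrix (Fin k) (Fin k) ℂ := fun x => Matrix.of fun i j => Λ (x j) i
  let S : Set ℝ := (fun x => ‖(M x).det‖) '' {x : Fin k → X | ∀ j, ‖x j‖ ≤ 1}
  have hbdd : BddAbove S := by
    refine ⟨(k.factorial : ℝ) * ‖Λ‖ ^ k, ?_⟩
    rintro _ ⟨x, hx, rfl⟩
    have := Matrix.det_le (A := M x) (abv := NormedField.toAbsoluteValue ℂ) (x := ‖Λ‖)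
      (fun i j => (norm_le_pi_norm (Λ (x j)) i).trans
        ((Λ.le_opNorm _).trans (mul_le_of_le_one_right (norm_nonneg _) (hx j))))
    rw [nsmul_eq_mul, Fintype.card_fin] at this
    exact this
  have hpos : ∃ x : Fin k → X, (∀ j, ‖x j‖ ≤ 1) ∧ 0 < ‖(M x).det‖ := by
    choose w hw using fun j : Fin k => hΛ (Pi.single j 1)
    let t : Fin k → ℝ := fun j => (1 + ‖w j‖)⁻¹
    have ht : ∀ j, 0 < t j := fun j => by positivity
    refine ⟨fun j => ((t j : ℝ) : ℂ) • w j, fun j => ?_, ?_⟩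
    · rw [norm_smul, norm_real, Real.norm_of_nonneg (ht j).le, inv_mul_le_iff₀ (by positivity)]
      linarith
    · have : M (fun j => ((t j : ℝ) : ℂ) • w j) = Matrix.diagonal fun j => ((t j : ℝ) : ℂ) := by
        ext i j
        simp only [M, Matrix.of_apply, map_smul, hw, Pi.smul_apply, smul_eq_mul,
          Matrix.diagonal_apply, Pi.single_apply]
        split_ifs with h
        · subst h; simp
        · simp
      rw [this, Matrix.det_diagonal, norm_pos_iff]
      exact Finset.prod_ne_zero_iff.2 fun j _ => by exact_mod_cast (ht j).ne'
  obtain ⟨x₀, hx₀, hx₀'⟩ := hpos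
  have hmem : ‖(M x₀).det‖ ∈ S := mem_image_of_mem (fun x => ‖(M x).det‖) (mem_ofPred.2 hx₀)
  have hsup : 0 < sSup S := hx₀'.trans_le (le_csSup hbdd hmem)
  obtain ⟨_, ⟨x, hx, rfl⟩, hlt⟩ := exists_lt_of_lt_csSup ⟨_, hmem⟩ (half_lt_self hsup)
  have hdet : (M x).det ≠ 0 := norm_pos_iff.1 ((half_pos hsup).trans hlt)
  -- Cramer's rule: φ j v is the quotient of determinants with x j replaced by v. For v in the unit
  -- ball the numerator is at most the supremum, hence the quotient is at most 2.
  let φ : Fin k → X →L[ℂ] ℂ := fun j =>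
    (M x).det⁻¹ • (LinearMap.toContinuousLinearMap
      ((LinearMap.proj j).comp (Matrix.cramer (M x)))).comp Λ
  have hφ : ∀ j v, φ j v = (M x).det⁻¹ * Matrix.cramer (M x) (Λ v) j := fun j v => rfl
  have hunit : ∀ j v, ‖v‖ ≤ 1 → ‖φ j v‖ ≤ 2 := by
    intro j v hv
    rw [hφ, norm_mul, norm_inv, inv_mul_le_iff₀ (norm_pos_iff.2 hdet), Matrix.cramer_apply]
    have h1 : (M x).updateCol j (Λ v) = M (Function.update x j v) := by
      ext a b
      by_cases hb : b = j
      · subst hb; simp [M]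
      · simp [M, hb]
    rw [h1]
    have h2 : ‖(M (Function.update x j v)).det‖ ≤ sSup S := by
      refine le_csSup hbdd (mem_image_of_mem (fun x => ‖(M x).det‖) fun b => ?_)
      by_cases hb : b = j
      · subst hb; simpa using hv
      · simpa [hb] using hx b
    linarith
  refine ⟨x, φ, hx, fun j => ?_, fun v => ?_, fun v hv j => by simp [hφ, hv]⟩
  · refine ContinuousLinearMap.opNorm_le_bound _ zero_le_two fun v => ?_
    rcases eq_or_ne v 0 with rfl | hv
    · simp
    have hn : 0 < ‖v‖ := norm_pos_iff.2 hv
    have h3 := hunit j (((‖v‖⁻¹ : ℝ) : ℂ) • v) (by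
      rw [norm_smul, norm_real, norm_inv, norm_norm, inv_mul_cancel₀ hn.ne'])
    rw [map_smul, norm_smul, norm_real, norm_inv, norm_norm, inv_mul_le_iff₀ hn] at h3
    linarith
  · have h4 : Λ (∑ j, φ j v • x j) = Matrix.mulVec (M x) (fun j => φ j v) := by
      ext i
      simp [Matrix.mulVec, dotProduct, M, mul_comm]
    have h5 : (fun j => φ j v) = (M x).det⁻¹ • Matrix.cramer (M x) (Λ v) := rfl
    rw [map_sub, h4, h5, Matrix.mulVec_smul, Matrix.mulVec_cramer, smul_smul,
      inv_mul_cancel₀ hdet, one_smul, sub_self]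

/-- Linear dependence among the functionals is removed by passing to the range of their joint map,
which leaves the common kernel unchanged. -/
theorem exists_biorthogonal {ι : Type*} [Fintype ι] (ℓ : ι → X →L[ℂ] ℂ) :
    ∃ k ≤ Fintype.card ι, ∃ (x : Fin k → X) (φ : Fin k → X →L[ℂ] ℂ),
      (∀ j, ‖x j‖ ≤ 1) ∧ (∀ j, ‖φ j‖ ≤ 2) ∧
      (∀ v i, ℓ i (v - ∑ j, φ j v • x j) = 0) ∧ ∀ v, (∀ i, ℓ i v = 0) → ∀ j, φ j v = 0 := by
  let Λ : X →L[ℂ] (ι → ℂ) := ContinuousLinearMap.pi ℓ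
  let R := LinearMap.range (Λ : X →ₗ[ℂ] (ι → ℂ))
  have hk : Module.finrank ℂ R ≤ Fintype.card ι :=
    (Submodule.finrank_le R).trans_eq (Module.finrank_fintype_fun_eq_card ℂ)
  let b := (Module.finBasis ℂ R).equivFun
  let Λ' : X →L[ℂ] (Fin (Module.finrank ℂ R) → ℂ) :=
    (LinearMap.toContinuousLinearMap (b : R →ₗ[ℂ] _)).comp
      (Λ.codRestrict R fun v => LinearMap.mem_range_self (Λ : X →ₗ[ℂ] (ι → ℂ)) v)
  have hker : ∀ v, Λ' v = 0 ↔ ∀ i, ℓ i v = 0 := by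
    intro v
    have : Λ' v = b ⟨Λ v, LinearMap.mem_range_self (Λ : X →ₗ[ℂ] (ι → ℂ)) v⟩ := rfl
    rw [this, b.map_eq_zero_iff, Subtype.ext_iff, funext_iff]
    rfl
  have hsurj : Function.Surjective Λ' := by
    intro w
    obtain ⟨v, hv⟩ := (b.symm w).2
    refine ⟨v, ?_⟩
    have : Λ' v = b ⟨Λ v, LinearMap.mem_range_self (Λ : X →ₗ[ℂ] (ι → ℂ)) v⟩ := rfl
    rw [this, show (⟨Λ v, _⟩ : R) = b.symm w from Subtype.ext hv, b.apply_symm_apply]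
  obtain ⟨x, φ, h1, h2, h3, h4⟩ := exists_biorthogonal_of_surjective Λ' hsurj
  exact ⟨_, hk, x, φ, h1, h2, fun v => (hker _).1 (h3 v), fun v hv => h4 v ((hker v).2 hv)⟩

end Nuclear

/-! ### Nuclearity from geometric decay on subspaces of finite codimension -/

section NuclearCriteria

variable {X Y : Type*} [NormedAddCommGroup X] [NormedSpace ℂ X]
  [NormedAddCommGroup Y] [NormedSpace ℂ Y] [CompleteSpace Y]

/-- Group N has at most (N + 1)M members, each O((N + 1)θ^N). After taking p-th powers the group
sums are still O((N + 1)²(θ^p)^N), and θ^p < 1. -/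
theorem summable_sigma_rpow {M : ℕ} {k : ℕ → ℕ} (hk : ∀ N, k N ≤ N * M) {B θ : ℝ}
    (hB : 0 ≤ B) (hθ0 : 0 ≤ θ) (hθ : θ < 1) {u : (Σ N, Fin (k (N + 1))) → ℝ}
    (hu0 : ∀ i, 0 ≤ u i) (hu : ∀ i, u i ≤ B * (i.1 + 1) * θ ^ i.1) {p : ℝ} (hp : 0 < p)
    (hp1 : p ≤ 1) : Summable fun i => u i ^ p := by
  have hterm : ∀ i, u i ^ p ≤ B ^ p * (i.1 + 1) * (θ ^ p) ^ i.1 := fun i => by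
    have h1 : (0 : ℝ) ≤ (i.1 : ℝ) + 1 := by positivity
    refine (Real.rpow_le_rpow (hu0 i) (hu i) hp.le).trans ?_
    rw [Real.mul_rpow (by positivity) (by positivity), Real.mul_rpow hB h1,
      ← Real.rpow_natCast θ, ← Real.rpow_mul hθ0, mul_comm (i.1 : ℝ) p, Real.rpow_mul hθ0,
      Real.rpow_natCast]
    have h2 : ((i.1 : ℝ) + 1) ^ p ≤ (i.1 : ℝ) + 1 := by
      simpa using Real.rpow_le_rpow_of_exponent_le (by linarith [(i.1).cast_nonneg (α := ℝ)] :
        (1 : ℝ) ≤ (i.1 : ℝ) + 1) hp1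
    gcongr
  rw [summable_sigma_of_nonneg fun i => Real.rpow_nonneg (hu0 i) p]
  refine ⟨fun N => Summable.of_finite, ?_⟩
  have hr : ‖θ ^ p‖ < 1 := by
    rw [Real.norm_of_nonneg (Real.rpow_nonneg hθ0 p)]
    exact Real.rpow_lt_one hθ0 hθ hp
  have hs2 := summable_pow_mul_geometric_of_norm_lt_one 2 hr
  have hs1 := summable_pow_mul_geometric_of_norm_lt_one 1 hr
  have hs0 := summable_pow_mul_geometric_of_norm_lt_one 0 hr
  have hs : Summable fun N : ℕ => (M * B ^ p) * (((N : ℝ) + 1) ^ 2 * (θ ^ p) ^ N) := by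
    refine Summable.mul_left _ (((hs2.add (hs1.mul_left 2)).add hs0).congr fun N => ?_)
    ring
  refine hs.of_nonneg_of_le (fun N => tsum_nonneg fun j => Real.rpow_nonneg (hu0 _) p) fun N => ?_
  rw [tsum_fintype]
  refine (Finset.sum_le_card_nsmul _ _ (B ^ p * (N + 1) * (θ ^ p) ^ N)
    fun j _ => hterm ⟨N, j⟩).trans ?_
  rw [Finset.card_univ, Fintype.card_fin, nsmul_eq_mul]
  have hkN : ((k (N + 1) : ℕ) : ℝ) ≤ (N + 1) * M := by exact_mod_cast hk (N + 1)
  have h0 : 0 ≤ θ ^ p := Real.rpow_nonneg hθ0 p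
  have h0' : 0 ≤ B ^ p := Real.rpow_nonneg hB p
  calc ((k (N + 1) : ℕ) : ℝ) * (B ^ p * (N + 1) * (θ ^ p) ^ N)
      ≤ ((N + 1) * M) * (B ^ p * (N + 1) * (θ ^ p) ^ N) := by gcongr
    _ = _ := by ring

/-- An operator that is geometrically small on the common kernels of the first `N` members of
finitely many sequences of functionals is nuclear of order zero. -/
theorem isNuclearOfOrderZero_of_vanishing {ι : Type*} [Fintype ι] (T : X →L[ℂ] Y)
    (ℓ : ℕ → ι → X →L[ℂ] ℂ) {C θ : ℝ} (hC : 0 ≤ C) (hθ0 : 0 ≤ θ) (hθ : θ < 1)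
    (h : ∀ N x, (∀ n < N, ∀ i, ℓ n i x = 0) → ‖T x‖ ≤ C * θ ^ N * ‖x‖) :
    IsNuclearOfOrderZero T := by
  choose k hk x φ hx hφ hker hkill using
    fun N : ℕ => exists_biorthogonal (fun i : Fin N × ι => ℓ i.1 i.2)
  set M := Fintype.card ι with hM
  have hk' : ∀ N, k N ≤ N * M := fun N => by simpa [hM] using hk N
  -- Projection onto the common kernel of the functionals with n < N. The uniform biorthogonal
  -- bounds keep its norm O(N + 1), which cannot spoil geometric decay.
  let Q : ℕ → X →L[ℂ] X := fun N =>
    ContinuousLinearMap.id ℂ X - ∑ j, (φ N j).smulRight (x N j)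
  have hQ : ∀ N v, Q N v = v - ∑ j, φ N j v • x N j := fun N v => by simp [Q]
  have hQker : ∀ N v, ∀ n < N, ∀ i, ℓ n i (Q N v) = 0 := fun N v n hn i => by
    rw [hQ]
    exact hker N v (⟨n, hn⟩, i)
  have hQQ : ∀ N v, Q N (Q (N + 1) v) = Q (N + 1) v := fun N v => by
    rw [hQ N, sub_eq_self]
    refine Finset.sum_eq_zero fun j _ => ?_
    rw [hkill N _ (fun i => hQker (N + 1) v i.1 (i.1.2.trans (Nat.lt_succ_self N)) i.2) j,
      zero_smul]
  have hQnorm : ∀ N v, ‖Q N v‖ ≤ (1 + 2 * M) * (N + 1) * ‖v‖ := fun N v => by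
    rw [hQ]
    have h1 : ‖∑ j, φ N j v • x N j‖ ≤ (k N : ℝ) * (2 * ‖v‖) := by
      refine (norm_sum_le_of_le (n := fun _ => 2 * ‖v‖) _ fun j _ => ?_).trans_eq (by simp)
      rw [norm_smul]
      exact (mul_le_of_le_one_right (norm_nonneg _) (hx N j)).trans
        ((φ N j).le_of_opNorm_le (hφ N j) v)
    have h2 : (k N : ℝ) ≤ N * M := by exact_mod_cast hk' N
    have h3 : (k N : ℝ) * (2 * ‖v‖) ≤ N * M * (2 * ‖v‖) := by gcongr
    have h4 : 0 ≤ (N : ℝ) * ‖v‖ := by positivity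
    have h5 : 0 ≤ (M : ℝ) * ‖v‖ := by positivity
    have := norm_sub_le v (∑ j, φ N j v • x N j)
    nlinarith
  have hTQ : ∀ N v, ‖T (Q N v)‖ ≤ C * (1 + 2 * M) * (N + 1) * θ ^ N * ‖v‖ := fun N v => by
    refine (h N _ (hQker N v)).trans ?_
    calc C * θ ^ N * ‖Q N v‖ ≤ C * θ ^ N * ((1 + 2 * M) * (N + 1) * ‖v‖) := by
          gcongr
          exact hQnorm N v
      _ = _ := by ring
  let Φ : (Σ N, Fin (k (N + 1))) → X →L[ℂ] ℂ := fun i => φ (i.1 + 1) i.2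
  let y : (Σ N, Fin (k (N + 1))) → Y := fun i => T (Q i.1 (x (i.1 + 1) i.2))
  have hbound : ∀ i, ‖Φ i‖ * ‖y i‖ ≤ 2 * (C * (1 + 2 * M)) * (i.1 + 1) * θ ^ i.1 := fun i => by
    have h1 : ‖y i‖ ≤ C * (1 + 2 * M) * (i.1 + 1) * θ ^ i.1 :=
      (hTQ i.1 _).trans (mul_le_of_le_one_right (by positivity) (hx _ _))
    calc ‖Φ i‖ * ‖y i‖ ≤ 2 * (C * (1 + 2 * M) * (i.1 + 1) * θ ^ i.1) :=
          mul_le_mul (hφ _ _) h1 (norm_nonneg _) zero_le_two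
      _ = _ := by ring
  have hs : ∀ p : ℝ, 0 < p → p ≤ 1 → Summable fun i => (‖Φ i‖ * ‖y i‖) ^ p := fun p hp hp1 =>
    summable_sigma_rpow hk' (by positivity) hθ0 hθ (fun i => by positivity) hbound hp hp1
  refine isNuclearOfOrderZero_of_hasSum fun p hp hp1 =>
    ⟨_, inferInstance, Φ, y, hs p hp hp1, fun v => ?_⟩
  have hsum : Summable fun i => Φ i v • y i := by
    refine Summable.of_norm_bounded ((hs 1 one_pos le_rfl).mul_left ‖v‖) fun i => ?_
    rw [Real.rpow_one, norm_smul]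
    calc ‖Φ i v‖ * ‖y i‖ ≤ (‖Φ i‖ * ‖v‖) * ‖y i‖ := by
          gcongr
          exact (Φ i).le_opNorm v
      _ = _ := by ring
  -- As Q_N Q_{N+1} = Q_{N+1}, the difference is T Q_N (1 - Q_{N+1}): it has finite rank and
  -- inherits the smallness of T Q_N. Telescoping recovers T, because Q_0 = 1 and T Q_N → 0.
  have hfib : ∀ N, HasSum (fun j => Φ ⟨N, j⟩ v • y ⟨N, j⟩) (T (Q N v) - T (Q (N + 1) v)) := by
    intro N
    have h1 : ∑ j, φ (N + 1) j v • x (N + 1) j = v - Q (N + 1) v := by rw [hQ]; abel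
    have h2 : T (Q N v) - T (Q (N + 1) v) = ∑ j, Φ ⟨N, j⟩ v • y ⟨N, j⟩ := by
      calc T (Q N v) - T (Q (N + 1) v) = T (Q N (v - Q (N + 1) v)) := by
            rw [map_sub, map_sub, hQQ]
        _ = _ := by
            rw [← h1]
            simp [Φ, y, map_sum]
    rw [h2]
    exact hasSum_fintype _
  have h1 := (hsum.hasSum.sigma hfib).tendsto_sum_nat
  have h2 : Tendsto (fun n => ∑ N ∈ Finset.range n, (T (Q N v) - T (Q (N + 1) v))) atTop
      (𝓝 (T v - 0)) := by
    have hQ0 : Q 0 v = v := by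
      rw [hQ, sub_eq_self]
      have hk0 : k 0 = 0 := by simpa using hk' 0
      refine Finset.sum_eq_zero fun j _ => ?_
      exact absurd j.2 (by omega)
    simp only [Finset.sum_range_sub', hQ0]
    refine tendsto_const_nhds.sub (squeeze_zero_norm (fun n => hTQ n v) ?_)
    have hr : ‖θ‖ < 1 := by rwa [Real.norm_of_nonneg hθ0]
    have ht := ((summable_pow_mul_geometric_of_norm_lt_one 1 hr).add
      (summable_pow_mul_geometric_of_norm_lt_one 0 hr)).tendsto_atTop_zero.const_mul
        (C * (1 + 2 * M) * ‖v‖)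
    rw [mul_zero] at ht
    refine ht.congr fun n => ?_
    ring
  have h3 := tendsto_nhds_unique h1 h2
  rw [sub_zero] at h3
  rw [← h3]
  exact hsum.hasSum

variable {Ω : Set ℂ} [IsBoundedOpen Ω]

theorem val_eq_pow_mul_of_vanishing {p : ℂ} (hp : p ∈ Ω) (f : BSpace Ω) (N : ℕ)
    (h : ∀ n < N, val (((shiftOp hp 1) ^ n) f) p = 0) {z : ℂ} (hz : z ∈ closure Ω) :
    val f z = (z - p) ^ N * val (((shiftOp hp 1) ^ N) f) z := by
  induction N with
  | zero => simp
  | succ N ih =>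
    have hz' : p + 1 * (z - p) ∈ closure Ω := by simpa using hz
    have h1 := val_eq_add_shiftOp hp 1 (((shiftOp hp 1) ^ N) f) hz'
    rw [h N (Nat.lt_succ_self N), zero_add, one_mul, add_sub_cancel] at h1
    rw [ih fun n hn => h n (hn.trans (Nat.lt_succ_self N)), h1, pow_succ' (shiftOp hp 1),
      mul_apply_eq_comp]
    ring

theorem norm_pow_shiftOp_le {p : ℂ} (hp : p ∈ Ω) {r : ℝ} (hr : 0 < r)
    (hball : Metric.ball p r ⊆ Ω) (f : BSpace Ω) (n : ℕ) :
    ‖((shiftOp hp 1) ^ n) f‖ ≤ (2 / r) ^ n * ‖f‖ := by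
  induction n with
  | zero =>
    rw [pow_zero, pow_zero, one_mul]
    exact le_rfl
  | succ n ih =>
    rw [pow_succ', mul_apply_eq_comp]
    refine (norm_shiftOp_le hp 1 hr hball _).trans ?_
    rw [norm_one, one_mul, pow_succ', mul_assoc]
    exact mul_le_mul_of_nonneg_left ih (by positivity)

/-- An operator on `B(Ω)` that is bounded by the supremum over a compact subset of `Ω` is nuclear
of order zero. -/
theorem isNuclearOfOrderZero_of_compact (T : BSpace Ω →L[ℂ] Y) {K : Set ℂ} (hK : IsCompact K)
    (hKΩ : K ⊆ Ω) {C : ℝ} (hC : 0 ≤ C)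
    (h : ∀ f ε, 0 ≤ ε → (∀ z ∈ K, ‖val f z‖ ≤ ε) → ‖T f‖ ≤ C * ε) : IsNuclearOfOrderZero T := by
  obtain ⟨r, hr, hrΩ⟩ := hK.exists_cthickening_subset_open (IsBoundedOpen.isOpen (Ω := Ω)) hKΩ
  -- Each shift costs a factor 2/r and each zero at the centre gains r/4, so the ratio is 1/2.
  obtain ⟨t, htK, htfin, hcov⟩ := hK.finite_cover_balls (e := r / 4) (by positivity)
  have := htfin.fintype
  have hball : ∀ p ∈ t, Metric.ball p r ⊆ Ω := fun p hp w hw =>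
    hrΩ (Metric.mem_cthickening_of_dist_le w p r K (htK hp) (Metric.mem_ball.1 hw).le)
  have hpΩ : ∀ p ∈ t, p ∈ Ω := fun p hp => hKΩ (htK hp)
  refine isNuclearOfOrderZero_of_vanishing T
    (fun n (i : t) => (evalCLM Ω i).comp ((shiftOp (hpΩ i i.2) 1) ^ n)) hC (θ := 1 / 2)
    (by norm_num) (by norm_num) fun N f hf => ?_
  rw [mul_assoc]
  refine h f _ (by positivity) fun z hz => ?_
  obtain ⟨p, hp, hzp⟩ := mem_iUnion₂.1 (hcov hz)
  rw [val_eq_pow_mul_of_vanishing (hpΩ p hp) f N (fun n hn => hf n hn ⟨p, hp⟩)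
    (subset_closure (hKΩ hz)), norm_mul, norm_pow]
  have h2 : ‖z - p‖ ≤ r / 4 := by
    rw [← dist_eq_norm]
    exact (Metric.mem_ball.1 hzp).le
  calc ‖z - p‖ ^ N * ‖val (((shiftOp (hpΩ p hp) 1) ^ N) f) z‖
      ≤ (r / 4) ^ N * ((2 / r) ^ N * ‖f‖) := by
        refine mul_le_mul (pow_le_pow_left₀ (norm_nonneg _) h2 N)
          ((norm_val_le _ z).trans (norm_pow_shiftOp_le _ hr (hball p hp) f N)) (norm_nonneg _)
          (by positivity)
    _ = (1 / 2) ^ N * ‖f‖ := by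
        rw [← mul_assoc, ← mul_pow]
        congr 2
        field_simp
        norm_num

end NuclearCriteria

/-! ## Parabolic sums in the half-plane of convergence -/

theorem differentiable_clm_apply_comp {E F G H : Type*} [NormedAddCommGroup E] [NormedSpace ℂ E]
    [NormedAddCommGroup F] [NormedSpace ℂ F] [NormedAddCommGroup G] [NormedSpace ℂ G]
    [NormedAddCommGroup H] [NormedSpace ℂ H] (B : E →L[ℂ] F →L[ℂ] G) {u : ℂ → E}
    (hu : Differentiable ℂ u) (C : H →L[ℂ] F) : Differentiable ℂ fun a => (B (u a)).comp C :=
  fun a => (B.differentiableAt.comp a (hu a)).clm_comp (differentiableAt_const C)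

section LogShift

variable {Ω' : Set ℂ} [IsBoundedOpen Ω']

theorem natCast_add_mem_slitPlane {w : ℂ} (hw : 0 < w.re) (n : ℕ) : (n : ℂ) + w ∈ slitPlane := by
  refine Or.inl ?_
  rw [add_re, natCast_re]
  positivity

theorem natCast_add_ne_zero {w : ℂ} (hw : 0 < w.re) (n : ℕ) : (n : ℂ) + w ≠ 0 :=
  slitPlane_ne_zero (natCast_add_mem_slitPlane hw n)

theorem natCast_le_norm_add {w : ℂ} (hw : 0 < w.re) (n : ℕ) : (n : ℝ) ≤ ‖(n : ℂ) + w‖ := by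
  refine le_trans ?_ (re_le_norm _)
  rw [add_re, natCast_re]
  linarith

variable {x : BSpace Ω'} (hx : ∀ z ∈ closure Ω', 0 < (val x z).re)

/-- The function `z ↦ log (n + x(z))`, for `x` with values in the right half-plane. -/
def logShift (n : ℕ) : BSpace Ω' :=
  ofFun (fun z => log ((n : ℂ) + val x z))
    ((continuousOn_const.add (continuousOn_val x)).clog fun z hz =>
      natCast_add_mem_slitPlane (hx z hz) n)
    (((differentiableOn_val x).const_add (n : ℂ)).clog fun z hz =>
      natCast_add_mem_slitPlane (hx z (subset_closure hz)) n)

theorem val_logShift (n : ℕ) {z : ℂ} (hz : z ∈ closure Ω') :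
    val (logShift hx n) z = log ((n : ℂ) + val x z) :=
  val_ofFun ((continuousOn_const.add (continuousOn_val x)).clog fun z hz =>
      natCast_add_mem_slitPlane (hx z hz) n)
    (((differentiableOn_val x).const_add (n : ℂ)).clog fun z hz =>
      natCast_add_mem_slitPlane (hx z (subset_closure hz)) n) hz

/-- The power `(n + x(z)) ^ (-a)`. -/
def powShift (n : ℕ) (a : ℂ) : BSpace Ω' := expB (logShift hx n) (-a)

theorem val_powShift (n : ℕ) (a : ℂ) {z : ℂ} (hz : z ∈ closure Ω') :
    val (powShift hx n a) z = exp (-a * log ((n : ℂ) + val x z)) := by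
  rw [powShift, val_expB _ _ hz, val_logShift hx n hz]

theorem differentiable_powShift (n : ℕ) : Differentiable ℂ (powShift hx n) :=
  (differentiable_expB (logShift hx n)).comp differentiable_neg

theorem val_powShift_add_one (n : ℕ) (a : ℂ) {z : ℂ} (hz : z ∈ closure Ω') :
    val (powShift hx n (a + 1)) z = val (powShift hx n a) z * ((n : ℂ) + val x z)⁻¹ := by
  have h0 := natCast_add_ne_zero (hx z hz) n
  rw [val_powShift hx n _ hz, val_powShift hx n _ hz,
    show -(a + 1) * log ((n : ℂ) + val x z)
      = -a * log ((n : ℂ) + val x z) + -log ((n : ℂ) + val x z) by ring, Complex.exp_add,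
    Complex.exp_neg (log _), exp_log h0]

/-- For y = n + 1 + x one has |y^{-a}| = |y|^{-Re a} e^{Im a · arg y}, with |y| ≥ n + 1 and |arg y|
≤ π. The bound is uniform on half-strips, as locally uniform convergence in a requires. -/
theorem norm_powShift_le (n : ℕ) {σ m : ℝ} (hσ : 0 ≤ σ) {a : ℂ} (ha : σ ≤ a.re)
    (hm : |a.im| ≤ m) :
    ‖powShift hx (n + 1) a‖ ≤ Real.exp (Real.pi * m) * ((n + 1 : ℕ) : ℝ) ^ (-σ) := by
  refine norm_le_of_val (by positivity) fun z hz => ?_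
  rw [val_powShift hx _ a hz, norm_exp]
  set y : ℂ := ((n + 1 : ℕ) : ℂ) + val x z with hy
  have hy1 : ((n + 1 : ℕ) : ℝ) ≤ ‖y‖ := natCast_le_norm_add (hx z hz) (n + 1)
  have h1 : (1 : ℝ) ≤ ((n + 1 : ℕ) : ℝ) := by exact_mod_cast Nat.le_add_left 1 n
  have hn : (0 : ℝ) < ((n + 1 : ℕ) : ℝ) := by linarith
  rw [Real.rpow_def_of_pos hn, ← Real.exp_add, Real.exp_le_exp]
  have h2 : (-a * log y).re = -a.re * Real.log ‖y‖ + a.im * arg y := by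
    rw [mul_re, log_re, log_im, neg_re, neg_im]
    ring
  have h3 : Real.log ((n + 1 : ℕ) : ℝ) ≤ Real.log ‖y‖ := Real.log_le_log hn hy1
  have h4 : 0 ≤ Real.log ((n + 1 : ℕ) : ℝ) := Real.log_nonneg h1
  have h5 : a.im * arg y ≤ Real.pi * m := by
    refine (le_abs_self _).trans ?_
    rw [abs_mul, mul_comm]
    exact mul_le_mul (abs_arg_le_pi y) hm (abs_nonneg _) Real.pi_pos.le
  have h6 : σ * Real.log ((n + 1 : ℕ) : ℝ) ≤ a.re * Real.log ‖y‖ :=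
    mul_le_mul ha h3 h4 (hσ.trans ha)
  rw [h2]
  linarith

theorem summable_natCast_succ_rpow {σ : ℝ} (hσ : 1 < σ) (C : ℝ) :
    Summable fun n : ℕ => C * ((n + 1 : ℕ) : ℝ) ^ (-σ) :=
  ((summable_nat_add_iff 1).2 (Real.summable_nat_rpow.2 (by linarith : -σ < -1))).mul_left C

variable {E : Type*} [NormedAddCommGroup E] [CompleteSpace E]

theorem summable_of_norm_le_rpow {F : ℕ → ℂ → E} (hF : ∀ (n : ℕ) (σ m : ℝ) (a : ℂ), 0 ≤ σ →
    σ ≤ a.re → |a.im| ≤ m → ‖F n a‖ ≤ Real.exp (Real.pi * m) * ((n + 1 : ℕ) : ℝ) ^ (-σ)) {a : ℂ}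
    (ha : 1 < a.re) : Summable fun n => F n a :=
  Summable.of_norm_bounded (summable_natCast_succ_rpow ha _) fun n =>
    hF n a.re |a.im| a (by linarith) le_rfl le_rfl

/-- Weierstrass M-test on the open half-strips Re b > σ > 1, |Im b| < m. It serves both the operator
sums and the zeta function. -/
theorem differentiableOn_tsum_of_norm_le_rpow [NormedSpace ℂ E] {F : ℕ → ℂ → E}
    (hF : ∀ (n : ℕ) (σ m : ℝ) (a : ℂ), 0 ≤ σ →
      σ ≤ a.re → |a.im| ≤ m → ‖F n a‖ ≤ Real.exp (Real.pi * m) * ((n + 1 : ℕ) : ℝ) ^ (-σ))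
    (hd : ∀ n, Differentiable ℂ (F n)) :
    DifferentiableOn ℂ (fun a => ∑' n, F n a) {a | 1 < a.re} := by
  intro a (ha : 1 < a.re)
  obtain ⟨σ, hσ1, hσ⟩ := exists_between ha
  obtain ⟨m, hm⟩ := exists_gt |a.im|
  let U : Set ℂ := {b | σ < b.re} ∩ {b | |b.im| < m}
  have hU : IsOpen U := (isOpen_lt continuous_const continuous_re).inter
    (isOpen_lt continuous_im.abs continuous_const)
  have h : DifferentiableOn ℂ (fun a => ∑' n, F n a) U := differentiableOn_tsum_of_summable_norm
    (summable_natCast_succ_rpow hσ1 (Real.exp (Real.pi * m)))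
    (fun n => (hd n).differentiableOn) hU fun n b hb =>
      hF n σ m b (by linarith) (le_of_lt hb.1) (le_of_lt hb.2)
  exact (h.differentiableAt (hU.mem_nhds ⟨hσ, hm⟩)).differentiableWithinAt

end LogShift

/-- The data defining the sum `∑_{n ≥ 1} (n + x(z)) ^ (-a) f(p + e / (n + x(z)))`. -/
structure ParabolicData (Ω Ω' : Set ℂ) (p e : ℂ) (x : BSpace Ω') : Prop where
  mem : p ∈ Ω
  re_pos : ∀ z ∈ closure Ω', 0 < (val x z).re
  maps : ∀ n : ℕ, ∀ z ∈ closure Ω', p + e * (((n + 1 : ℕ) : ℂ) + val x z)⁻¹ ∈ Ω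

namespace ParabolicData

variable {Ω Ω' : Set ℂ} {p e : ℂ} {x : BSpace Ω'} (D : ParabolicData Ω Ω' p e x)

theorem continuousOn_point (D : ParabolicData Ω Ω' p e x) (n : ℕ) :
    ContinuousOn (fun z => p + e * (((n + 1 : ℕ) : ℂ) + val x z)⁻¹) (closure Ω') :=
  continuousOn_const.add (continuousOn_const.mul
    ((continuousOn_const.add (continuousOn_val x)).inv₀ fun z hz =>
      natCast_add_ne_zero (D.re_pos z hz) (n + 1)))

theorem differentiableOn_point (D : ParabolicData Ω Ω' p e x) (n : ℕ) :
    DifferentiableOn ℂ (fun z => p + e * (((n + 1 : ℕ) : ℂ) + val x z)⁻¹) Ω' :=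
  ((((differentiableOn_val x).const_add _).inv fun z hz =>
      natCast_add_ne_zero (D.re_pos z (subset_closure hz)) (n + 1)).const_mul e).const_add p

variable [IsBoundedOpen Ω']

/-- The `n`-th summand of the parabolic sum, as an operator. -/
def term (n : ℕ) (a : ℂ) : BSpace Ω →L[ℂ] BSpace Ω' :=
  (mulB Ω' (powShift D.re_pos (n + 1) a)).comp
    (compOp _ (D.maps n) (D.continuousOn_point n) (D.differentiableOn_point n))

theorem val_term (n : ℕ) (a : ℂ) (f : BSpace Ω) {z : ℂ} (hz : z ∈ closure Ω') :
    val (D.term n a f) z = val (powShift D.re_pos (n + 1) a) z *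
      val f (p + e * (((n + 1 : ℕ) : ℂ) + val x z)⁻¹) := by
  rw [term, ContinuousLinearMap.comp_apply, val_mulB]
  congr 1
  exact val_compOp (D.maps n) (D.continuousOn_point n) (D.differentiableOn_point n) f hz

theorem norm_term_le (n : ℕ) (a : ℂ) : ‖D.term n a‖ ≤ ‖powShift D.re_pos (n + 1) a‖ := by
  refine (ContinuousLinearMap.opNorm_comp_le _ _).trans ?_
  exact (mul_le_of_le_one_right (norm_nonneg _) (norm_compOp_le _ _ _)).trans (norm_mulB_le _)

theorem differentiable_term (n : ℕ) : Differentiable ℂ (D.term n) :=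
  differentiable_clm_apply_comp (mulB Ω') (differentiable_powShift D.re_pos (n + 1)) _

/-- The operator `f ↦ ∑_{n ≥ 1} (n + x(z)) ^ (-a) f(p + e / (n + x(z)))`, `Re a > 1`. -/
def parSum (a : ℂ) : BSpace Ω →L[ℂ] BSpace Ω' := ∑' n, D.term n a

theorem norm_term_le_rpow (n : ℕ) (σ m : ℝ) (a : ℂ) (hσ : 0 ≤ σ) (ha : σ ≤ a.re)
    (hm : |a.im| ≤ m) : ‖D.term n a‖ ≤ Real.exp (Real.pi * m) * ((n + 1 : ℕ) : ℝ) ^ (-σ) :=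
  (D.norm_term_le n a).trans (norm_powShift_le D.re_pos n hσ ha hm)

theorem summable_term {a : ℂ} (ha : 1 < a.re) : Summable fun n => D.term n a :=
  summable_of_norm_le_rpow (E := BSpace Ω →L[ℂ] BSpace Ω') (F := D.term) D.norm_term_le_rpow ha

theorem hasSum_parSum {a : ℂ} (ha : 1 < a.re) (f : BSpace Ω) {z : ℂ} (hz : z ∈ closure Ω') :
    HasSum (fun n : ℕ => val (powShift D.re_pos (n + 1) a) z *
      val f (p + e * (((n + 1 : ℕ) : ℂ) + val x z)⁻¹)) (val (D.parSum a f) z) := by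
  have h := (D.summable_term ha).hasSum.mapL
    ((evalCLM Ω' z).comp (ContinuousLinearMap.apply ℂ (BSpace Ω') f))
  exact h.congr_fun fun n => (D.val_term n a f hz).symm

theorem differentiableOn_parSum : DifferentiableOn ℂ D.parSum {a | 1 < a.re} :=
  differentiableOn_tsum_of_norm_le_rpow (E := BSpace Ω →L[ℂ] BSpace Ω') (F := D.term)
    D.norm_term_le_rpow D.differentiable_term

variable [IsBoundedOpen Ω]

/-- The points converge to p uniformly in z, since |n + 1 + x| ≥ n + 1. A closed ball about p
catches all but finitely many n, and the others give compact images. -/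
theorem exists_compact (D : ParabolicData Ω Ω' p e x) : ∃ K : Set ℂ, IsCompact K ∧ K ⊆ Ω ∧
    ∀ n : ℕ, ∀ z ∈ closure Ω', p + e * (((n + 1 : ℕ) : ℂ) + val x z)⁻¹ ∈ K := by
  obtain ⟨r, hr, hball⟩ := Metric.nhds_basis_closedBall.mem_iff.1
    ((IsBoundedOpen.isOpen (Ω := Ω)).mem_nhds D.mem)
  obtain ⟨N, hN⟩ := exists_nat_gt (‖e‖ / r)
  refine ⟨Metric.closedBall p r ∪ ⋃ n ∈ Finset.range N,
    (fun z => p + e * (((n + 1 : ℕ) : ℂ) + val x z)⁻¹) '' closure Ω', ?_, ?_, fun n z hz => ?_⟩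
  · exact (isCompact_closedBall p r).union ((Finset.range N).isCompact_biUnion fun n _ =>
      (isCompact_closure_of_isBoundedOpen Ω').image_of_continuousOn (D.continuousOn_point n))
  · refine union_subset hball (iUnion₂_subset fun n _ => ?_)
    rintro _ ⟨z, hz, rfl⟩
    exact D.maps n z hz
  · by_cases hn : n < N
    · exact Or.inr (mem_iUnion₂.2 ⟨n, Finset.mem_range.2 hn, z, hz, rfl⟩)
    · refine Or.inl ?_
      have h1 := natCast_le_norm_add (D.re_pos z hz) (n + 1)
      have h2 : (N : ℝ) ≤ ((n + 1 : ℕ) : ℝ) := by exact_mod_cast (by omega : N ≤ n + 1)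
      have h3 : 0 < ‖((n + 1 : ℕ) : ℂ) + val x z‖ :=
        norm_pos_iff.2 (natCast_add_ne_zero (D.re_pos z hz) (n + 1))
      rw [Metric.mem_closedBall, dist_eq_norm, add_sub_cancel_left, norm_mul, norm_inv,
        ← div_eq_mul_inv, div_le_iff₀ h3]
      rw [div_lt_iff₀ hr] at hN
      nlinarith

theorem isNuclearOfOrderZero_parSum {a : ℂ} (ha : 1 < a.re) :
    IsNuclearOfOrderZero (D.parSum a) := by
  obtain ⟨K, hK, hKΩ, hmem⟩ := D.exists_compact
  have hs := summable_natCast_succ_rpow ha (Real.exp (Real.pi * |a.im|))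
  have h0 : 0 ≤ ∑' n : ℕ, Real.exp (Real.pi * |a.im|) * ((n + 1 : ℕ) : ℝ) ^ (-a.re) :=
    tsum_nonneg fun n => by positivity
  refine isNuclearOfOrderZero_of_compact _ hK hKΩ h0 fun f ε hε hf =>
    norm_le_of_val (mul_nonneg h0 hε) fun z hz => ?_
  refine (D.hasSum_parSum ha f hz).norm_le_of_bounded (hs.hasSum.mul_right ε) fun n => ?_
  rw [norm_mul]
  exact mul_le_mul
    ((norm_val_le _ z).trans (norm_powShift_le D.re_pos n (by linarith) le_rfl le_rfl))
      (hf _ (hmem n z hz)) (norm_nonneg _) (by positivity)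

/-- Splitting off the constant Taylor coefficient. -/
theorem parSum_eq (a : ℂ) (ha : 1 < a.re) (f one : BSpace Ω)
    (hone : ∀ z ∈ closure Ω, val one z = 1) :
    D.parSum a f = val f p • D.parSum a one + D.parSum (a + 1) (shiftOp D.mem e f) := by
  have ha' : 1 < (a + 1).re := by rw [add_re, one_re]; linarith
  refine ext_val fun z hz => ?_
  rw [val_add, val_smul]
  refine (D.hasSum_parSum ha f hz).unique ?_
  refine (((D.hasSum_parSum ha one hz).mul_left (val f p)).add
    (D.hasSum_parSum ha' (shiftOp D.mem e f) hz)).congr_fun fun n => ?_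
  have hmem : p + e * (((n + 1 : ℕ) : ℂ) + val x z)⁻¹ ∈ closure Ω :=
    subset_closure (D.maps n z hz)
  rw [val_eq_add_shiftOp D.mem e f hmem, hone _ hmem, val_powShift_add_one D.re_pos _ _ hz]
  ring

end ParabolicData

/-! ## The Hurwitz zeta function with holomorphic parameter -/

/-- Any two extensions agree for Re a > 1, hence on their common half-plane by the identity theorem,
so they glue. -/
theorem exists_entire_extension {E : Type*} [NormedAddCommGroup E] [NormedSpace ℂ E]
    [CompleteSpace E] {Z : ℂ → E}
    (h : ∀ m : ℕ, ∃ W : ℂ → E, DifferentiableOn ℂ W {a | 1 - (m : ℝ) < a.re} ∧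
      ∀ a : ℂ, 1 < a.re → W a = Z a) :
    ∃ W : ℂ → E, Differentiable ℂ W ∧ ∀ a : ℂ, 1 < a.re → W a = Z a := by
  choose w hw hwZ using h
  have hopen : ∀ c : ℝ, IsOpen {a : ℂ | c < a.re} := fun c =>
    isOpen_lt continuous_const continuous_re
  have heq : ∀ m n : ℕ, ∀ a : ℂ, 1 - (m : ℝ) < a.re → 1 - (n : ℝ) < a.re → w m a = w n a := by
    intro m n
    suffices H : ∀ m n : ℕ, m ≤ n → ∀ a : ℂ, 1 - (m : ℝ) < a.re → w m a = w n a by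
      rcases le_total m n with h | h
      · exact fun a ha _ => H m n h a ha
      · exact fun a _ ha => (H n m h a ha).symm
    intro m n hmn a ha
    have hsub : {a : ℂ | 1 - (m : ℝ) < a.re} ⊆ {a : ℂ | 1 - (n : ℝ) < a.re} := by
      intro b (hb : 1 - (m : ℝ) < b.re)
      have : (m : ℝ) ≤ n := by exact_mod_cast hmn
      exact lt_of_le_of_lt (by linarith) hb
    have h2 : (2 : ℂ) ∈ {a : ℂ | 1 - (m : ℝ) < a.re} := by
      have : (0 : ℝ) ≤ m := m.cast_nonneg
      change 1 - (m : ℝ) < (2 : ℂ).re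
      norm_num
      linarith
    refine ((hw m).analyticOnNhd (hopen _)).eqOn_of_preconnected_of_eventuallyEq
      (((hw n).mono hsub).analyticOnNhd (hopen _))
      (convex_halfSpace_re_gt (1 - (m : ℝ))).isPreconnected h2 ?_ ha
    filter_upwards [(hopen 1).mem_nhds (show (2 : ℂ) ∈ {a : ℂ | (1 : ℝ) < a.re} by
      simp)] with b hb
    rw [hwZ m b hb, hwZ n b hb]
  let N : ℂ → ℕ := fun a => ⌊1 - a.re⌋₊ + 1
  have hN : ∀ a, 1 - (N a : ℝ) < a.re := fun a => by
    have := Nat.lt_floor_add_one (1 - a.re)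
    simp only [N]
    push_cast
    linarith
  refine ⟨fun a => w (N a) a, fun a => ?_, fun a ha => hwZ _ a ha⟩
  have h1 : (fun b => w (N b) b) =ᶠ[𝓝 a] w (N a) := by
    filter_upwards [(hopen _).mem_nhds (hN a)] with b hb
    exact heq _ _ b (hN b) hb
  exact ((hw (N a)).differentiableAt ((hopen _).mem_nhds (hN a))).congr_of_eventuallyEq h1

section ZetaSum

variable {Ω' : Set ℂ} [IsBoundedOpen Ω'] {x : BSpace Ω'}
  (hx : ∀ z ∈ closure Ω', 0 < (val x z).re)

/-- The sum `∑_{n ≥ 1} (n + x(z)) ^ (-a)` for `Re a > 1`. -/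
def zetaSum (a : ℂ) : BSpace Ω' := ∑' n, powShift hx (n + 1) a

theorem hasSum_zetaSum {a : ℂ} (ha : 1 < a.re) (z : ℂ) :
    HasSum (fun n : ℕ => val (powShift hx (n + 1) a) z) (val (zetaSum hx a) z) :=
  (summable_of_norm_le_rpow (F := fun n a => powShift hx (n + 1) a)
    (fun n _ _ _ h1 h2 h3 => norm_powShift_le hx n h1 h2 h3) ha).hasSum.mapL (evalCLM Ω' z)

theorem differentiableOn_zetaSum : DifferentiableOn ℂ (zetaSum hx) {a | 1 < a.re} :=
  differentiableOn_tsum_of_norm_le_rpow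
    (fun n _ _ _ h1 h2 h3 => norm_powShift_le hx n h1 h2 h3)
    fun n => differentiable_powShift hx (n + 1)

end ZetaSum

/-- The constant function `1`. -/
def oneB (Ω : Set ℂ) [IsBoundedOpen Ω] : BSpace Ω :=
  ofFun (fun _ => 1) continuousOn_const (differentiableOn_const 1)

theorem val_oneB {Ω : Set ℂ} [IsBoundedOpen Ω] {z : ℂ} (hz : z ∈ closure Ω) :
    val (oneB Ω) z = 1 := val_ofFun continuousOn_const (differentiableOn_const 1) hz

namespace ParabolicData

variable {Ω Ω' : Set ℂ} {p e : ℂ} {x : BSpace Ω'} (D : ParabolicData Ω Ω' p e x)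
  [IsBoundedOpen Ω] [IsBoundedOpen Ω']

theorem parSum_oneB {a : ℂ} (ha : 1 < a.re) : D.parSum a (oneB Ω) = zetaSum D.re_pos a := by
  refine ext_val fun z hz => (D.hasSum_parSum ha (oneB Ω) hz).unique ?_
  refine (hasSum_zetaSum D.re_pos ha z).congr_fun fun n => ?_
  rw [val_oneB (subset_closure (D.maps n z hz)), mul_one]

theorem parSum_eq_add {a : ℂ} (ha : 1 < a.re) (f : BSpace Ω) :
    D.parSum a f = val f p • zetaSum D.re_pos a + D.parSum (a + 1) (shiftOp D.mem e f) := by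
  rw [D.parSum_eq a ha f (oneB Ω) fun z hz => val_oneB hz, D.parSum_oneB ha]

theorem parSum_eq_sum_add {a : ℂ} (ha : 1 < a.re) (f : BSpace Ω) (m : ℕ) :
    D.parSum a f =
      ∑ j ∈ Finset.range m, val (((shiftOp D.mem e) ^ j) f) p • zetaSum D.re_pos (a + j) +
        D.parSum (a + m) (((shiftOp D.mem e) ^ m) f) := by
  induction m with
  | zero =>
    rw [Finset.sum_range_zero, zero_add, Nat.cast_zero, add_zero, pow_zero]
    rfl
  | succ m ih =>
    have ham : 1 < (a + m).re := by
      rw [add_re, natCast_re]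
      have : (0 : ℝ) ≤ m := m.cast_nonneg
      linarith
    rw [ih, D.parSum_eq_add ham, Finset.sum_range_succ, pow_succ' _ m,
      mul_apply_eq_comp, Nat.cast_succ, ← add_assoc a]
    exact (add_assoc _ _ _).symm

end ParabolicData

/-! ### Iterated shifts and Taylor coefficients -/

section TaylorCoefficients

variable {Ω : Set ℂ} [IsBoundedOpen Ω] {p : ℂ} (hp : p ∈ Ω) (e : ℂ)

theorem hasFPowerSeriesAt_shiftOp {f : BSpace Ω} {P : FormalMultilinearSeries ℂ ℂ ℂ}
    (h : HasFPowerSeriesAt (val f) P p) :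
    HasFPowerSeriesAt (val (shiftOp hp e f)) (e • P.fslope) p := by
  have h1 := h.has_fpower_series_dslope_fslope.const_smul (c := e)
  refine h1.congr ?_
  filter_upwards [(IsBoundedOpen.isOpen (Ω := Ω)).mem_nhds hp] with z hz
  rw [val_shiftOp hp e f (subset_closure hz)]
  rfl

/-- Each shift drops the leading Taylor coefficient and multiplies the rest by e. -/
theorem val_pow_shiftOp_apply (j : ℕ) {f : BSpace Ω} {P : FormalMultilinearSeries ℂ ℂ ℂ}
    (h : HasFPowerSeriesAt (val f) P p) :
    val (((shiftOp hp e) ^ j) f) p = e ^ j * P.coeff j := by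
  induction j generalizing f P with
  | zero =>
    rw [pow_zero, pow_zero, one_mul]
    exact (h.coeff_zero (fun _ => 1)).symm
  | succ j ih =>
    rw [pow_succ (shiftOp hp e), mul_apply_eq_comp, ih (hasFPowerSeriesAt_shiftOp hp e h)]
    have : (e • P.fslope).coeff j = e * P.coeff (j + 1) := by
      rw [← FormalMultilinearSeries.coeff_fslope]
      rfl
    rw [this]
    ring

end TaylorCoefficients

theorem ring_choose_succ_mul (r : ℂ) (k : ℕ) :
    Ring.choose r (k + 1) * (k + 1) = Ring.choose r k * (r - k) := by
  have h0 : (k.factorial : ℂ) ≠ 0 := by exact_mod_cast k.factorial_ne_zero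
  have hk : (k : ℂ) + 1 ≠ 0 := by exact_mod_cast k.succ_ne_zero
  rw [Ring.choose_eq_smul, Ring.choose_eq_smul, descPochhammer_succ_right,
    Polynomial.smeval_mul, Polynomial.smeval_sub, Polynomial.smeval_X,
    Polynomial.smeval_natCast, Nat.factorial_succ]
  simp only [smul_eq_mul, pow_zero, pow_one, nsmul_eq_mul, mul_one]
  push_cast
  field_simp

/-! ### Binomial series on a disc of radius less than one -/

section BinomialDisc

variable {ρ : ℝ}

instance isBoundedOpen_ball (c : ℂ) (r : ℝ) : IsBoundedOpen (Metric.ball c r) :=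
  ⟨Metric.isOpen_ball, Metric.isBounded_ball⟩

theorem one_add_mem_slitPlane_of_mem_closure (hρ : ρ < 1) {v : ℂ}
    (hv : v ∈ closure (Metric.ball (0 : ℂ) ρ)) : 1 + v ∈ slitPlane := by
  have h := Metric.closure_ball_subset_closedBall hv
  rw [mem_closedBall_zero_iff] at h
  exact mem_slitPlane_of_norm_lt_one (h.trans_lt hρ)

/-- The function `log (1 + v)` on a disc of radius less than one. -/
def logOneAdd (hρ : ρ < 1) : BSpace (Metric.ball (0 : ℂ) ρ) :=
  ofFun (fun v => log (1 + v))
    ((continuousOn_const.add continuousOn_id).clog fun _ hv =>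
      one_add_mem_slitPlane_of_mem_closure hρ hv)
    ((differentiableOn_id.const_add 1).clog fun _ hv =>
      one_add_mem_slitPlane_of_mem_closure hρ (subset_closure hv))

/-- The function `(1 + v) ^ (1 - a)` on a disc of radius less than one. -/
def powOneAdd (hρ : ρ < 1) (a : ℂ) : BSpace (Metric.ball (0 : ℂ) ρ) :=
  expB (logOneAdd hρ) (1 - a)

theorem val_powOneAdd (hρ : ρ < 1) (a : ℂ) {v : ℂ} (hv : v ∈ closure (Metric.ball (0 : ℂ) ρ)) :
    val (powOneAdd hρ a) v = exp ((1 - a) * log (1 + v)) := by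
  rw [powOneAdd, val_expB _ _ hv]
  congr 2
  exact val_ofFun ((continuousOn_const.add continuousOn_id).clog fun _ hv =>
      one_add_mem_slitPlane_of_mem_closure hρ hv)
    ((differentiableOn_id.const_add 1).clog fun _ hv =>
      one_add_mem_slitPlane_of_mem_closure hρ (subset_closure hv)) hv

theorem differentiable_powOneAdd (hρ : ρ < 1) : Differentiable ℂ (powOneAdd hρ) :=
  (differentiable_expB (logOneAdd hρ)).comp ((differentiable_const 1).sub differentiable_id)

theorem hasFPowerSeriesAt_powOneAdd (hρ0 : 0 < ρ) (hρ : ρ < 1) (a : ℂ) :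
    HasFPowerSeriesAt (val (powOneAdd hρ a)) (binomialSeries ℂ (1 - a)) 0 := by
  refine (one_add_cpow_hasFPowerSeriesAt_zero (a := 1 - a)).congr ?_
  filter_upwards [Metric.ball_mem_nhds (0 : ℂ) hρ0] with v hv
  rw [val_powOneAdd hρ a (subset_closure hv), cpow_def_of_ne_zero
    (slitPlane_ne_zero (one_add_mem_slitPlane_of_mem_closure hρ (subset_closure hv))), mul_comm]

/-- The Taylor coefficients of `(1 - u) ^ (1 - a)`. -/
def binCoeff (hρ0 : 0 < ρ) (hρ : ρ < 1) (j : ℕ) (a : ℂ) : ℂ :=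
  val (((shiftOp (Metric.mem_ball_self (x := (0 : ℂ)) hρ0) (-1)) ^ j) (powOneAdd hρ a)) 0

theorem binCoeff_eq (hρ0 : 0 < ρ) (hρ : ρ < 1) (j : ℕ) (a : ℂ) :
    binCoeff hρ0 hρ j a = (-1) ^ j * Ring.choose (1 - a) j := by
  rw [binCoeff, val_pow_shiftOp_apply _ _ _ (hasFPowerSeriesAt_powOneAdd hρ0 hρ a), binomialSeries,
    FormalMultilinearSeries.coeff_ofScalars]

theorem binCoeff_zero (hρ0 : 0 < ρ) (hρ : ρ < 1) (a : ℂ) : binCoeff hρ0 hρ 0 a = 1 := by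
  rw [binCoeff_eq, Ring.choose_zero_right, pow_zero, one_mul]

/-- The exposed factor a + j - 1 is what cancels the pole of ζ(a + j) in the zeta recursion. -/
theorem binCoeff_succ (hρ0 : 0 < ρ) (hρ : ρ < 1) (j : ℕ) (a : ℂ) :
    binCoeff hρ0 hρ (j + 1) a = binCoeff hρ0 hρ j a / (j + 1) * (a + j - 1) := by
  have h := ring_choose_succ_mul (1 - a) j
  have hj : (j : ℂ) + 1 ≠ 0 := by exact_mod_cast j.succ_ne_zero
  rw [binCoeff_eq, binCoeff_eq, pow_succ]
  field_simp
  linear_combination -h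

theorem differentiable_binCoeff (hρ0 : 0 < ρ) (hρ : ρ < 1) (j : ℕ) :
    Differentiable ℂ (binCoeff hρ0 hρ j) :=
  ((evalCLM _ 0).comp
    ((shiftOp (Metric.mem_ball_self (x := (0 : ℂ)) hρ0) (-1)) ^ j)).differentiable.comp
      (differentiable_powOneAdd hρ)

end BinomialDisc

/-! ### Entire continuation of (a - 1) ζ(a, x) -/

section ZetaContinuation

variable {Ω' : Set ℂ} [IsBoundedOpen Ω'] {x : BSpace Ω'}

/-- By compactness Re x ≥ δ > 0, so |n + 1 + x| > 1 + δ/2. The points -1/(n + 1 + x) therefore stay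
in a disc of radius less than 1, where log(1 + v) is holomorphic. -/
theorem exists_parabolicData_disc (hx : ∀ z ∈ closure Ω', 0 < (val x z).re) :
    ∃ ρ : ℝ, 0 < ρ ∧ ρ < 1 ∧ ParabolicData (Metric.ball (0 : ℂ) ρ) Ω' 0 (-1) x := by
  obtain ⟨δ, hδ, hδx⟩ := (isCompact_closure_of_isBoundedOpen Ω').exists_forall_le'
    (continuous_re.comp_continuousOn (continuousOn_val x)) hx
  have hδ' : ∀ z ∈ closure Ω', δ ≤ (val x z).re := hδx
  refine ⟨(1 + δ / 2)⁻¹, by positivity, inv_lt_one_of_one_lt₀ (by linarith),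
    Metric.mem_ball_self (by positivity), hx, fun n z hz => ?_⟩
  have h1 : 1 + δ / 2 < ‖((n + 1 : ℕ) : ℂ) + val x z‖ := by
    refine lt_of_lt_of_le ?_ (re_le_norm _)
    rw [add_re, natCast_re]
    have := hδ' z hz
    push_cast
    have : (0 : ℝ) ≤ n := n.cast_nonneg
    linarith
  rw [zero_add, mem_ball_zero_iff, neg_one_mul, norm_neg, norm_inv]
  exact inv_strictAnti₀ (by positivity) h1

/-- The argument is (n + w)/(n + 1 + w). Both terms lie in the right half-plane, so their arguments
differ by less than π and no multiple of 2πi appears. -/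
theorem log_one_sub_inv {w : ℂ} (hw : 0 < w.re) (n : ℕ) :
    log (1 + -(((n + 1 : ℕ) : ℂ) + w)⁻¹) =
      log ((n : ℂ) + w) - log (((n + 1 : ℕ) : ℂ) + w) := by
  have h1 := natCast_add_ne_zero hw n
  have h2 := natCast_add_ne_zero hw (n + 1)
  have harg : ∀ m : ℕ, |arg ((m : ℂ) + w)| < Real.pi / 2 := fun m => by
    rw [abs_arg_lt_pi_div_two_iff]
    refine Or.inl ?_
    rw [add_re, natCast_re]
    positivity
  have h3 := abs_lt.1 (harg n)
  have h4 := abs_lt.1 (harg (n + 1))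
  rw [← log_exp (x := log ((n : ℂ) + w) - log (((n + 1 : ℕ) : ℂ) + w)), Complex.exp_sub, exp_log h1,
    exp_log h2]
  · congr 1
    field_simp
    push_cast
    ring
  · rw [sub_im, log_im, log_im]
    linarith
  · rw [sub_im, log_im, log_im]
    linarith

variable (hx : ∀ z ∈ closure Ω', 0 < (val x z).re)

/-- Telescoping. -/
theorem parSum_shiftOp_powOneAdd {ρ : ℝ} (hρ0 : 0 < ρ) (hρ : ρ < 1)
    (D : ParabolicData (Metric.ball (0 : ℂ) ρ) Ω' 0 (-1) x) {a : ℂ} (ha : 1 < a.re) :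
    D.parSum a (shiftOp (Metric.mem_ball_self hρ0) (-1) (powOneAdd hρ a)) =
      powShift D.re_pos 0 (a - 1) := by
  refine ext_val fun z hz => ?_
  set w := val x z with hw
  have hw0 : 0 < w.re := D.re_pos z hz
  -- With u = 1/(n + 1 + x), the shift of F(v) = (1 + v)^{1-a} satisfies u (G F)(-u) = (1 - u)^{1-a}
  -- - 1. Multiplied by (n + 1 + x)^{1-a}, this is (n + x)^{1-a} - (n + 1 + x)^{1-a}.
  have hterm : ∀ n : ℕ, val (powShift D.re_pos (n + 1) a) z *
      val (shiftOp (Metric.mem_ball_self hρ0) (-1) (powOneAdd hρ a))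
        (0 + -1 * (((n + 1 : ℕ) : ℂ) + val x z)⁻¹) =
      val (powShift D.re_pos n (a - 1)) z - val (powShift D.re_pos (n + 1) (a - 1)) z := by
    intro n
    have hy := natCast_add_ne_zero hw0 (n + 1)
    have hmem : (0 : ℂ) + -1 * (((n + 1 : ℕ) : ℂ) + w)⁻¹ ∈ closure (Metric.ball (0 : ℂ) ρ) :=
      subset_closure (D.maps n z hz)
    have h1 := val_eq_add_shiftOp (Metric.mem_ball_self hρ0) (-1) (powOneAdd hρ a) hmem
    have h2 : val (powOneAdd hρ a) 0 = 1 := by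
      rw [val_powOneAdd hρ a (subset_closure (Metric.mem_ball_self hρ0))]
      simp
    have h3 : val (powOneAdd hρ a) (0 + -1 * (((n + 1 : ℕ) : ℂ) + w)⁻¹) =
        exp ((1 - a) * (log ((n : ℂ) + w) - log (((n + 1 : ℕ) : ℂ) + w))) := by
      rw [val_powOneAdd hρ a hmem, zero_add, neg_one_mul, log_one_sub_inv hw0]
    rw [h2, h3] at h1
    have h4 := val_powShift_add_one D.re_pos (n + 1) (a - 1) hz
    rw [sub_add_cancel] at h4
    have h5 : val (powShift D.re_pos (n + 1) (a - 1)) z *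
        exp ((1 - a) * (log ((n : ℂ) + w) - log (((n + 1 : ℕ) : ℂ) + w))) =
        val (powShift D.re_pos n (a - 1)) z := by
      rw [val_powShift D.re_pos _ _ hz, val_powShift D.re_pos _ _ hz, ← Complex.exp_add]
      congr 1
      ring
    rw [h4, ← h5, h1, ← hw]
    ring
  have h1 := (D.hasSum_parSum ha
    (shiftOp (Metric.mem_ball_self hρ0) (-1) (powOneAdd hρ a)) hz).tendsto_sum_nat
  simp only [hterm, Finset.sum_range_sub'] at h1
  have hzero : Tendsto (fun n => val (powShift D.re_pos n (a - 1)) z) atTop (𝓝 0) := by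
    rw [← tendsto_add_atTop_iff_nat 1]
    have hσ : 0 < (a - 1).re := by rw [sub_re, one_re]; linarith
    refine squeeze_zero_norm (fun n => (norm_val_le _ z).trans
      (norm_powShift_le D.re_pos n hσ.le le_rfl le_rfl)) ?_
    rw [← mul_zero (Real.exp (Real.pi * |(a - 1).im|))]
    refine Tendsto.const_mul _ ?_
    exact ((tendsto_rpow_neg_atTop hσ).comp tendsto_natCast_atTop_atTop).comp
      (tendsto_add_atTop_nat 1)
  have h2 := tendsto_nhds_unique h1 (tendsto_const_nhds.sub hzero)
  rw [h2, sub_zero]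

/-- The recursion for `(a - 1) ζ(a)`. -/
theorem zetaSum_recursion {ρ : ℝ} (hρ0 : 0 < ρ) (hρ : ρ < 1)
    (D : ParabolicData (Metric.ball (0 : ℂ) ρ) Ω' 0 (-1) x) {a : ℂ} (ha : 1 < a.re) (m : ℕ) :
    (a - 1) • zetaSum D.re_pos a = powShift D.re_pos 0 (a - 1) -
      (∑ j ∈ Finset.range m, (binCoeff hρ0 hρ (j + 1) a / (j + 2)) •
        ((a + (j + 1 : ℕ) - 1) • zetaSum D.re_pos (a + (j + 1 : ℕ)))) -
      D.parSum (a + (m + 1 : ℕ))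
        (((shiftOp (Metric.mem_ball_self (x := (0 : ℂ)) hρ0) (-1)) ^ (m + 2)) (powOneAdd hρ a)) := by
  have h1 := parSum_shiftOp_powOneAdd hρ0 hρ D ha
  rw [D.parSum_eq_sum_add ha _ (m + 1)] at h1
  have hcomp : ∀ j : ℕ, ((shiftOp D.mem (-1)) ^ j)
      (shiftOp (Metric.mem_ball_self hρ0) (-1) (powOneAdd hρ a)) =
      ((shiftOp (Metric.mem_ball_self (x := (0 : ℂ)) hρ0) (-1)) ^ (j + 1)) (powOneAdd hρ a) :=
    fun j => by rw [pow_succ, mul_apply_eq_comp]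
  simp only [hcomp] at h1
  have hcoef : ∀ j : ℕ, val (((shiftOp (Metric.mem_ball_self (x := (0 : ℂ)) hρ0) (-1)) ^ (j + 1))
      (powOneAdd hρ a)) 0 = binCoeff hρ0 hρ j a / (j + 1) * (a + j - 1) :=
    fun j => binCoeff_succ hρ0 hρ j a
  simp only [hcoef, mul_smul] at h1
  -- The term j = 0 is (a - 1) ζ(a) itself, as the leading binomial coefficient is 1; the remaining
  -- indices move up by one, whence the denominators j + 2.
  rw [Finset.sum_range_succ', binCoeff_zero] at h1
  rw [← h1]
  have h2 : ∀ j : ℕ, ((j + 1 : ℕ) : ℂ) + 1 = (j : ℂ) + 2 := fun j => by push_cast; ring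
  simp only [h2, Nat.cast_zero, add_zero, zero_add, div_one, one_smul]
  abel

theorem differentiableOn_clm_apply {E F : Type*} [NormedAddCommGroup E] [NormedSpace ℂ E]
    [NormedAddCommGroup F] [NormedSpace ℂ F] {T : ℂ → E →L[ℂ] F} {U : Set ℂ}
    (hT : DifferentiableOn ℂ T U) {g : ℂ → ℂ} {V : Set ℂ} (hg : Differentiable ℂ g)
    (hgV : MapsTo g V U) (A : E →L[ℂ] E) {u : ℂ → E} (hu : Differentiable ℂ u) :
    DifferentiableOn ℂ (fun a => T (g a) (A (u a))) V :=
  (hT.comp hg.differentiableOn hgV).clm_apply (A.differentiable.comp hu).differentiableOn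

/-- Each term on the right of the recursion involves an argument shifted by at least 1, and the
remainder is shifted by m + 1. So continuation to Re a > 1 - m yields continuation to Re a > -m. -/
theorem exists_zeta_halfPlane (m : ℕ) :
    ∃ W : ℂ → BSpace Ω', DifferentiableOn ℂ W {a | 1 - (m : ℝ) < a.re} ∧
      ∀ a : ℂ, 1 < a.re → W a = (a - 1) • zetaSum hx a := by
  induction m with
  | zero =>
    refine ⟨fun a => (a - 1) • zetaSum hx a, ?_, fun a _ => rfl⟩
    simp only [Nat.cast_zero, sub_zero]
    exact (differentiableOn_id.sub_const 1).smul (differentiableOn_zetaSum hx)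
  | succ m ih =>
    obtain ⟨W, hW, hWZ⟩ := ih
    obtain ⟨ρ, hρ0, hρ, D⟩ := exists_parabolicData_disc hx
    have hre : ∀ (a : ℂ) (j : ℕ), (a + (j : ℂ)).re = a.re + j := fun a j => by
      rw [add_re, natCast_re]
    have hre' : ∀ j : ℕ, Differentiable ℂ fun a : ℂ => a + (j : ℂ) := fun j =>
      differentiable_id.add_const _
    refine ⟨fun a => powShift hx 0 (a - 1) -
      (∑ j ∈ Finset.range m, (binCoeff hρ0 hρ (j + 1) a / (j + 2)) • W (a + (j + 1 : ℕ))) -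
      D.parSum (a + (m + 1 : ℕ)) (((shiftOp (Metric.mem_ball_self (x := (0 : ℂ)) hρ0) (-1)) ^ (m + 2))
        (powOneAdd hρ a)), ?_, fun a ha => ?_⟩
    · refine (DifferentiableOn.sub ?_ (DifferentiableOn.fun_sum fun j _ => ?_)).sub ?_
      · exact ((differentiable_powShift hx 0).comp
          (differentiable_id.sub_const 1)).differentiableOn
      · have hWj : DifferentiableOn ℂ (fun a => W (a + (j + 1 : ℕ)))
            {a | 1 - ((m + 1 : ℕ) : ℝ) < a.re} := by
          refine hW.comp (hre' (j + 1)).differentiableOn ?_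
          intro a (ha : 1 - ((m + 1 : ℕ) : ℝ) < a.re)
          change 1 - (m : ℝ) < (a + ((j + 1 : ℕ) : ℂ)).re
          rw [hre]
          push_cast at ha ⊢
          linarith [j.cast_nonneg (α := ℝ)]
        exact DifferentiableOn.smul
          ((differentiable_binCoeff hρ0 hρ (j + 1)).div_const _).differentiableOn hWj
      · refine differentiableOn_clm_apply D.differentiableOn_parSum
          (hre' (m + 1)) ?_ _ (differentiable_powOneAdd hρ)
        intro a (ha : 1 - ((m + 1 : ℕ) : ℝ) < a.re)
        change 1 < (a + ((m + 1 : ℕ) : ℂ)).re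
        rw [hre]
        linarith
    · have hWj : ∀ j : ℕ, W (a + (j + 1 : ℕ)) =
          (a + (j + 1 : ℕ) - 1) • zetaSum hx (a + (j + 1 : ℕ)) := fun j => by
        refine hWZ _ ?_
        rw [hre]
        linarith [(j + 1).cast_nonneg (α := ℝ)]
      simp only [hWj]
      exact (zetaSum_recursion hρ0 hρ D ha m).symm

/-- `(a - 1) ∑_{n ≥ 1} (n + x(z)) ^ (-a)` extends to an entire function of `a`. -/
theorem exists_zeta_continuation :
    ∃ W : ℂ → BSpace Ω', Differentiable ℂ W ∧
      ∀ a : ℂ, 1 < a.re → W a = (a - 1) • zetaSum hx a :=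
  exists_entire_extension (exists_zeta_halfPlane hx)

end ZetaContinuation

/-! ## Operator families with simple poles of finite rank -/

section SimplePole

variable {X Y Z : Type} [NormedAddCommGroup X] [NormedSpace ℂ X]
  [NormedAddCommGroup Y] [NormedSpace ℂ Y] [NormedAddCommGroup Z] [NormedSpace ℂ Z]

/-- A family of nuclear operators of order zero, holomorphic off `P` in operator norm, with
at most simple poles at the points of `P`, of rank at most `r`. -/
structure SimplePoleFamily (P : Set ℂ) (r : ℕ) (T : ℂ → X →L[ℂ] Y) : Prop where
  nuclear : ∀ s ∉ P, IsNuclearOfOrderZero (T s)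
  differentiableAt : ∀ s ∉ P, DifferentiableAt ℂ T s
  exists_local : ∀ s₀ ∈ P, ∃ (V : Set ℂ) (A B : ℂ → X →L[ℂ] Y),
    IsOpen V ∧ s₀ ∈ V ∧ DifferentiableOn ℂ A V ∧ DifferentiableOn ℂ B V ∧
      (∀ s ∈ V, s ≠ s₀ → T s = (s - s₀)⁻¹ • A s + B s) ∧
      ∀ s ∈ V, LinearMap.rank (A s : X →ₗ[ℂ] Y) ≤ r

theorem SimplePoleFamily.of_entire (P : Set ℂ) {T : ℂ → X →L[ℂ] Y} (hT : Differentiable ℂ T)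
    (hn : ∀ s, IsNuclearOfOrderZero (T s)) : SimplePoleFamily P 0 T where
  nuclear s _ := hn s
  differentiableAt s _ := hT s
  exists_local s₀ _ := ⟨univ, fun _ => 0, T, isOpen_univ, mem_univ _, differentiableOn_const 0,
    hT.differentiableOn, fun s _ _ => by simp, fun s _ => by simp⟩

namespace SimplePoleFamily

variable {P : Set ℂ} {r r' : ℕ} {T T' : ℂ → X →L[ℂ] Y}

theorem add (h : SimplePoleFamily P r T) (h' : SimplePoleFamily P r' T') :
    SimplePoleFamily P (r + r') fun s => T s + T' s where
  nuclear s hs := (h.nuclear s hs).add (h'.nuclear s hs)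
  differentiableAt s hs := (h.differentiableAt s hs).add (h'.differentiableAt s hs)
  exists_local s₀ hs₀ := by
    obtain ⟨V, A, B, hV, hmem, hA, hB, hT, hr⟩ := h.exists_local s₀ hs₀
    obtain ⟨V', A', B', hV', hmem', hA', hB', hT', hr'⟩ := h'.exists_local s₀ hs₀
    refine ⟨V ∩ V', fun s => A s + A' s, fun s => B s + B' s, hV.inter hV', ⟨hmem, hmem'⟩,
      (hA.mono inter_subset_left).add (hA'.mono inter_subset_right),
      (hB.mono inter_subset_left).add (hB'.mono inter_subset_right), fun s hs hne => ?_,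
      fun s hs => ?_⟩
    · rw [hT s hs.1 hne, hT' s hs.2 hne, smul_add]
      exact add_add_add_comm _ _ _ _
    · rw [Nat.cast_add]
      exact (LinearMap.rank_add_le (A s : X →ₗ[ℂ] Y) (A' s : X →ₗ[ℂ] Y)).trans
        (add_le_add (hr s hs.1) (hr' s hs.2))

theorem comp_right (h : SimplePoleFamily P r T) (M : Z →L[ℂ] X) :
    SimplePoleFamily P r fun s => (T s).comp M where
  nuclear s hs := (h.nuclear s hs).comp_right M
  differentiableAt s hs := (h.differentiableAt s hs).clm_comp (differentiableAt_const M)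
  exists_local s₀ hs₀ := by
    obtain ⟨V, A, B, hV, hmem, hA, hB, hT, hr⟩ := h.exists_local s₀ hs₀
    refine ⟨V, fun s => (A s).comp M, fun s => (B s).comp M, hV, hmem,
      hA.clm_comp (differentiableOn_const M), hB.clm_comp (differentiableOn_const M),
      fun s hs hne => ?_, fun s hs => ?_⟩
    · rw [hT s hs hne, ContinuousLinearMap.add_comp, ContinuousLinearMap.smul_comp]
    · exact (LinearMap.rank_comp_le_left (M : Z →ₗ[ℂ] X) (A s : X →ₗ[ℂ] Y)).trans (hr s hs)

theorem comp_left (h : SimplePoleFamily P r T) {M : ℂ → Y →L[ℂ] Z} (hM : Differentiable ℂ M) :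
    SimplePoleFamily P r fun s => (M s).comp (T s) where
  nuclear s hs := (h.nuclear s hs).comp_left (M s)
  differentiableAt s hs := (hM s).clm_comp (h.differentiableAt s hs)
  exists_local s₀ hs₀ := by
    obtain ⟨V, A, B, hV, hmem, hA, hB, hT, hr⟩ := h.exists_local s₀ hs₀
    refine ⟨V, fun s => (M s).comp (A s), fun s => (M s).comp (B s), hV, hmem,
      hM.differentiableOn.clm_comp hA, hM.differentiableOn.clm_comp hB,
      fun s hs hne => ?_, fun s hs => ?_⟩
    · rw [hT s hs hne, ContinuousLinearMap.comp_add, ContinuousLinearMap.comp_smul]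
    · exact (LinearMap.rank_comp_le_right (A s : X →ₗ[ℂ] Y) (M s : Y →ₗ[ℂ] Z)).trans (hr s hs)

/-- Since (cs - cs₀)⁻¹ = c⁻¹ (s - s₀)⁻¹, the constant is absorbed into the polar family. Used with c
= 2. -/
theorem comp_mul (h : SimplePoleFamily P r T) {c : ℂ} (hc : c ≠ 0) :
    SimplePoleFamily {s | c * s ∈ P} r fun s => T (c * s) where
  nuclear s hs := h.nuclear (c * s) hs
  differentiableAt s hs := DifferentiableAt.comp (g := T) s (h.differentiableAt (c * s) hs)
    (differentiableAt_id.const_mul c)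
  exists_local s₀ hs₀ := by
    obtain ⟨V, A, B, hV, hmem, hA, hB, hT, hr⟩ := h.exists_local (c * s₀) hs₀
    have hd : Differentiable ℂ fun s : ℂ => c * s := differentiable_id.const_mul c
    have hAc : DifferentiableOn ℂ (fun s => A (c * s)) ((fun s => c * s) ⁻¹' V) :=
      hA.comp hd.differentiableOn fun _ hs => hs
    refine ⟨(fun s => c * s) ⁻¹' V, fun s => c⁻¹ • A (c * s), fun s => B (c * s),
      hV.preimage (continuous_const.mul continuous_id), hmem, hAc.fun_const_smul _,
      hB.comp hd.differentiableOn fun _ hs => hs, fun s hs hne => ?_, fun s hs => ?_⟩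
    · rw [hT (c * s) hs fun h => hne (mul_left_cancel₀ hc h), smul_smul, ← mul_inv,
        mul_comm (s - s₀), mul_sub]
    · refine le_trans ?_ (hr (c * s) hs)
      exact LinearMap.rank_comp_le_right (A (c * s) : X →ₗ[ℂ] Y)
        (c⁻¹ • LinearMap.id : Y →ₗ[ℂ] Y)

end SimplePoleFamily

theorem rank_smulRight_le_one (c : X →L[ℂ] ℂ) (y : Y) :
    LinearMap.rank (c.smulRight y : X →ₗ[ℂ] Y) ≤ (1 : ℕ) := by
  refine (LinearMap.rank_comp_le_right (c : X →ₗ[ℂ] ℂ) (LinearMap.toSpanSingleton ℂ Y y)).trans ?_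
  refine (LinearMap.rank_le_range _).trans ?_
  simp

end SimplePole

/-! ### Continuation by a shift relation -/

section ShiftContinuation

variable {X Y : Type} [NormedAddCommGroup X] [NormedSpace ℂ X]
  [NormedAddCommGroup Y] [NormedSpace ℂ Y]

/-- The rank one operators occurring as polar parts. -/
def polarTerm (δ : X →L[ℂ] ℂ) (G : X →L[ℂ] X) (W : ℂ → Y) (k : ℕ) (a : ℂ) : X →L[ℂ] Y :=
  (δ.comp (G ^ k)).smulRight (W (a + k))

/-- The continuation to `Re a > 1 - N`. -/
def shiftContinuation (δ : X →L[ℂ] ℂ) (G : X →L[ℂ] X) (W : ℂ → Y) (Φ : ℂ → X →L[ℂ] Y) (N : ℕ)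
    (a : ℂ) : X →L[ℂ] Y :=
  ∑ k ∈ Finset.range N, (a + k - 1)⁻¹ • polarTerm δ G W k a + (Φ (a + N)).comp (G ^ N)

variable {δ : X →L[ℂ] ℂ} {G : X →L[ℂ] X} {W : ℂ → Y} {Φ : ℂ → X →L[ℂ] Y}

theorem differentiable_polarTerm (hW : Differentiable ℂ W) (k : ℕ) :
    Differentiable ℂ (polarTerm δ G W k) :=
  (ContinuousLinearMap.smulRightL ℂ X Y (δ.comp (G ^ k))).differentiable.comp
    (hW.comp (differentiable_id.add_const (k : ℂ)))

/-- At a + N, still in the half-plane of convergence, the shift relation turns the remainder into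
the next polar term and the next remainder. -/
theorem shiftContinuation_succ
    (hrec : ∀ a : ℂ, 1 < a.re →
      Φ a = (a - 1)⁻¹ • δ.smulRight (W a) + (Φ (a + 1)).comp G)
    {N : ℕ} {a : ℂ} (ha : 1 - (N : ℝ) < a.re) :
    shiftContinuation δ G W Φ N a = shiftContinuation δ G W Φ (N + 1) a := by
  have h1 : 1 < (a + (N : ℂ)).re := by
    rw [add_re, natCast_re]
    linarith
  rw [shiftContinuation, shiftContinuation, Finset.sum_range_succ, hrec _ h1, add_assoc,
    ContinuousLinearMap.add_comp, ContinuousLinearMap.smul_comp, Nat.cast_succ, pow_succ' G N]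
  exact (add_assoc _ _ _).symm

theorem shiftContinuation_eq
    (hrec : ∀ a : ℂ, 1 < a.re →
      Φ a = (a - 1)⁻¹ • δ.smulRight (W a) + (Φ (a + 1)).comp G)
    {N M : ℕ} {a : ℂ} (hN : 1 - (N : ℝ) < a.re) (hM : 1 - (M : ℝ) < a.re) :
    shiftContinuation δ G W Φ N a = shiftContinuation δ G W Φ M a := by
  wlog hNM : N ≤ M generalizing N M
  · exact (this hM hN (le_of_not_ge hNM)).symm
  induction M, hNM using Nat.le_induction with
  | base => rfl
  | succ M hNM ih =>
    have hM' : 1 - (M : ℝ) < a.re := by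
      have : (N : ℝ) ≤ M := by exact_mod_cast hNM
      linarith
    rw [ih hM', shiftContinuation_succ hrec hM']

theorem differentiableAt_shift_comp (hΦ : DifferentiableOn ℂ Φ {a | 1 < a.re}) {N : ℕ} {a : ℂ}
    (ha : 1 - (N : ℝ) < a.re) :
    DifferentiableAt ℂ (fun a => (Φ (a + N)).comp (G ^ N)) a := by
  have h1 : a + (N : ℂ) ∈ {a : ℂ | 1 < a.re} := by
    change 1 < (a + (N : ℂ)).re
    rw [add_re, natCast_re]
    linarith
  have h2 := hΦ.differentiableAt ((isOpen_lt continuous_const continuous_re).mem_nhds h1)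
  exact (DifferentiableAt.comp a h2 (differentiableAt_id.add_const (N : ℂ))).clm_comp
    (differentiableAt_const _)

theorem differentiableAt_polar_sum (hW : Differentiable ℂ W) {N : ℕ} {a : ℂ}
    (ha : ∀ k < N, a + (k : ℂ) - 1 ≠ 0) :
    DifferentiableAt ℂ
      (fun a => ∑ k ∈ Finset.range N, (a + (k : ℂ) - 1)⁻¹ • polarTerm δ G W k a) a :=
  DifferentiableAt.fun_sum fun k hk =>
    (((differentiableAt_id.add_const (k : ℂ)).sub_const 1).inv
      (ha k (Finset.mem_range.1 hk))).smul (differentiable_polarTerm hW k a)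

/-- The truncations agree wherever both are defined, so at each point any sufficiently large N may
be used. The factor a + k - 1 then vanishes only at 1 - k. -/
theorem exists_simplePoleFamily_of_shift (hW : Differentiable ℂ W)
    (hΦ : DifferentiableOn ℂ Φ {a | 1 < a.re})
    (hn : ∀ a : ℂ, 1 < a.re → IsNuclearOfOrderZero (Φ a))
    (hrec : ∀ a : ℂ, 1 < a.re →
      Φ a = (a - 1)⁻¹ • δ.smulRight (W a) + (Φ (a + 1)).comp G) :
    ∃ T : ℂ → X →L[ℂ] Y, SimplePoleFamily {a | ∃ k : ℕ, a = 1 - k} 1 T ∧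
      ∀ a : ℂ, 1 < a.re → T a = Φ a := by
  let N : ℂ → ℕ := fun a => ⌊1 - a.re⌋₊ + 1
  have hN : ∀ a, 1 - (N a : ℝ) < a.re := fun a => by
    have := Nat.lt_floor_add_one (1 - a.re)
    simp only [N]
    push_cast
    linarith
  let T : ℂ → X →L[ℂ] Y := fun a => shiftContinuation δ G W Φ (N a) a
  have hT : ∀ (M : ℕ) (a : ℂ), 1 - (M : ℝ) < a.re → T a = shiftContinuation δ G W Φ M a :=
    fun M a ha => shiftContinuation_eq hrec (hN a) ha
  refine ⟨T, ⟨fun a _ => ?_, fun a ha => ?_, ?_⟩, fun a ha => ?_⟩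
  · refine IsNuclearOfOrderZero.add (IsNuclearOfOrderZero.sum _ fun k _ =>
      (isNuclearOfOrderZero_smulRight _ _).const_smul _) ((hn _ ?_).comp_right _)
    rw [add_re, natCast_re]
    linarith [hN a]
  · have h1 : T =ᶠ[𝓝 a] shiftContinuation δ G W Φ (N a) := by
      filter_upwards [(isOpen_lt continuous_const continuous_re).mem_nhds (hN a)] with b hb
      exact hT _ b hb
    refine DifferentiableAt.congr_of_eventuallyEq ?_ h1
    refine (differentiableAt_polar_sum hW fun k _ h => ha ⟨k, ?_⟩).add
      (differentiableAt_shift_comp hΦ (hN a))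
    linear_combination h
  · rintro _ ⟨k, rfl⟩
    -- On the unit disc about 1 - k the truncation N = k + 1 is valid. The poles 1 - j with j < k
    -- are at distance at least 1, so only the last summand is singular.
    have hVre : ∀ a ∈ Metric.ball (1 - (k : ℂ)) 1, 1 - ((k + 1 : ℕ) : ℝ) < a.re := by
      intro a ha
      rw [Metric.mem_ball, dist_eq_norm] at ha
      have h1 := (abs_lt.1 ((abs_re_le_norm _).trans_lt ha)).1
      rw [sub_re, sub_re, one_re, natCast_re] at h1
      push_cast
      linarith
    refine ⟨Metric.ball (1 - (k : ℂ)) 1, polarTerm δ G W k, fun a =>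
      ∑ j ∈ Finset.range k, (a + j - 1)⁻¹ • polarTerm δ G W j a +
        (Φ (a + (k + 1 : ℕ))).comp (G ^ (k + 1)), Metric.isOpen_ball,
      Metric.mem_ball_self one_pos, (differentiable_polarTerm hW k).differentiableOn,
      fun a ha => ?_, fun a ha _ => ?_, fun a _ => rank_smulRight_le_one _ _⟩
    · refine ((differentiableAt_polar_sum hW fun j hj h => ?_).add
        (differentiableAt_shift_comp hΦ (hVre a ha))).differentiableWithinAt
      have h1 : a = 1 - (j : ℂ) := by linear_combination h
      have h2 := hVre a ha
      rw [Metric.mem_ball, dist_eq_norm, h1] at ha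
      have h3 := (abs_lt.1 ((abs_re_le_norm _).trans_lt ha)).2
      simp only [sub_re, one_re, natCast_re] at h3
      have h4 : (j : ℝ) + 1 ≤ k := by exact_mod_cast hj
      linarith
    · rw [hT _ a (hVre a ha), shiftContinuation, Finset.sum_range_succ,
        show a - (1 - (k : ℂ)) = a + k - 1 by ring, add_comm (∑ j ∈ Finset.range k, _), add_assoc]
  · rw [hT 0 a (by simpa using ha), shiftContinuation]
    simp only [Finset.sum_range_zero, zero_add, Nat.cast_zero, add_zero, pow_zero]
    exact ContinuousLinearMap.comp_id _

end ShiftContinuation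

theorem ParabolicData.exists_simplePoleFamily {Ω Ω' : Set ℂ} [IsBoundedOpen Ω] [IsBoundedOpen Ω']
    {p e : ℂ} {x : BSpace Ω'} (D : ParabolicData Ω Ω' p e x) :
    ∃ T : ℂ → BSpace Ω →L[ℂ] BSpace Ω', SimplePoleFamily {a | ∃ k : ℕ, a = 1 - k} 1 T ∧
      ∀ a : ℂ, 1 < a.re → T a = D.parSum a := by
  obtain ⟨W, hW, hWZ⟩ := exists_zeta_continuation D.re_pos
  refine exists_simplePoleFamily_of_shift (δ := evalCLM Ω p) (G := shiftOp D.mem e) hW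
    D.differentiableOn_parSum (fun a ha => D.isNuclearOfOrderZero_parSum ha) fun a ha => ?_
  refine ContinuousLinearMap.ext fun f => ?_
  have ha1 : a - 1 ≠ 0 := by
    intro h
    have := congrArg re h
    rw [sub_re, one_re, zero_re] at this
    linarith
  rw [D.parSum_eq_add ha f, hWZ a ha]
  change _ = (a - 1)⁻¹ • (val f p • ((a - 1) • zetaSum D.re_pos a)) + _
  rw [smul_comm (val f p), inv_smul_smul₀ ha1]
  rfl

/-! ## The individual terms of the transfer operator -/

theorem differentiable_den (b : SL2R) : Differentiable ℂ (den b) :=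
  (differentiable_id.const_mul _).add_const _

theorem differentiableOn_moeb (b : SL2R) {A : Set ℂ} (h : ∀ z ∈ A, den b z ≠ 0) :
    DifferentiableOn ℂ (moeb b) A :=
  ((differentiable_id.const_mul _).add_const _).differentiableOn.div
    (differentiable_den b).differentiableOn h

/-- Off the branch cut the automorphy factor is exp(s g) with g in B(Ω'), hence entire in s. The
image of the closure of Ω' is a compact subset of Ω, which gives nuclearity. -/
theorem exists_hyperbolic_family {Ω Ω' : Set ℂ} [IsBoundedOpen Ω] [IsBoundedOpen Ω'] {b : SL2R}
    (hmaps : MapsInto b (closure Ω') Ω)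
    (hslit : ∀ z ∈ closure Ω', (den b z) ^ (-2 : ℤ) ∈ slitPlane) :
    ∃ H : ℂ → BSpace Ω →L[ℂ] BSpace Ω', Differentiable ℂ H ∧
      (∀ s, IsNuclearOfOrderZero (H s)) ∧
      ∀ s f, ∀ z ∈ closure Ω', val (H s f) z = jfac s b z * val f (moeb b z) := by
  have hden : ∀ z ∈ closure Ω', den b z ≠ 0 := fun z hz => (hmaps z hz).1
  have hd : DifferentiableOn ℂ (fun z => (den b z) ^ (-2 : ℤ)) (closure Ω') :=
    (differentiable_den b).differentiableOn.zpow (Or.inl hden)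
  have hm := differentiableOn_moeb b hden
  have hmap : MapsTo (moeb b) (closure Ω') Ω := fun z hz => (hmaps z hz).2
  have hlogc : ContinuousOn (fun z => log ((den b z) ^ (-2 : ℤ))) (closure Ω') :=
    hd.continuousOn.clog hslit
  have hlogd : DifferentiableOn ℂ (fun z => log ((den b z) ^ (-2 : ℤ))) Ω' :=
    (hd.mono subset_closure).clog fun z hz => hslit z (subset_closure hz)
  let g : BSpace Ω' := ofFun _ hlogc hlogd
  let C : BSpace Ω →L[ℂ] BSpace Ω' :=
    compOp (moeb b) hmap hm.continuousOn (hm.mono subset_closure)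
  have hval : ∀ s f, ∀ z ∈ closure Ω',
      val ((mulB Ω' (expB g s)) (C f)) z = jfac s b z * val f (moeb b z) := by
    intro s f z hz
    rw [val_mulB, val_expB g s hz, val_compOp hmap hm.continuousOn (hm.mono subset_closure) f hz,
      val_ofFun hlogc hlogd hz, jfac, cpow_def_of_ne_zero (slitPlane_ne_zero (hslit z hz)),
      mul_comm s]
  refine ⟨fun s => (mulB Ω' (expB g s)).comp C,
    differentiable_clm_apply_comp (mulB Ω') (differentiable_expB g) C, fun s => ?_, hval⟩
  refine isNuclearOfOrderZero_of_compact _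
    ((isCompact_closure_of_isBoundedOpen Ω').image_of_continuousOn hm.continuousOn)
    (image_subset_iff.2 hmap) (norm_nonneg (expB g s)) fun f ε hε hf =>
      norm_le_of_val (by positivity) fun z hz => ?_
  rw [ContinuousLinearMap.comp_apply, val_mulB, norm_mul,
    val_compOp hmap hm.continuousOn (hm.mono subset_closure) f hz]
  exact mul_le_mul (norm_val_le _ z) (hf _ (mem_image_of_mem _ hz)) (norm_nonneg _)
    (norm_nonneg _)

/-! ### Powers of parabolic elements -/

/-- The powers of `b` are, up to sign, the parabolic transformations with fixed point `σ = ± 1`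
that become translations by multiples of `c` in the coordinate `1 / (1 - σ z)`. -/
def HasParabolicPowers (b : SL2R) (σ c : ℝ) : Prop :=
  ∀ (n : ℕ) (z : ℂ), ∃ ε : ℂ, ε ^ 2 = 1 ∧ den (b ^ n) z = ε * (1 + n * c * (1 - σ * z)) ∧
    moeb (b ^ n) z = (z + σ * (n * c * (1 - σ * z))) / (1 + n * c * (1 - σ * z))

/-- With x = (cw)⁻¹ and y = 1 + ncw one has yx = n + x. Both x and y lie in the right half-plane, so
log(yx) = log y + log x, and |Im(2 log y)| < π makes -2 log y the principal logarithm of y^{-2}. -/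
theorem cpow_neg_two_eq {w : ℂ} (hw : 0 < w.re) {c : ℝ} (hc : 0 < c) (n : ℕ) (s : ℂ) :
    ((1 + n * c * w) ^ (-2 : ℤ)) ^ s =
      exp (2 * s * log ((c * w)⁻¹)) * exp (-(2 * s) * log (n + (c * w)⁻¹)) := by
  have hcw : 0 < (c * w).re := by
    rw [re_ofReal_mul]
    positivity
  have hcw0 : c * w ≠ 0 := fun h => by
    rw [h, zero_re] at hcw
    exact lt_irrefl _ hcw
  have hx : 0 < ((c * w)⁻¹).re := by
    rw [inv_re]
    exact div_pos hcw (normSq_pos.2 hcw0)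
  set x := (c * w)⁻¹ with hxdef
  have hx0 : x ≠ 0 := inv_ne_zero hcw0
  set y : ℂ := 1 + n * c * w with hydef
  have hy : 0 < y.re := by
    rw [hydef, mul_assoc, add_re, one_re, ← ofReal_natCast, re_ofReal_mul]
    positivity
  have hy0 : y ≠ 0 := fun h => by
    rw [h, zero_re] at hy
    exact lt_irrefl _ hy
  have hyx : y * x = n + x := by
    rw [hydef, hxdef, mul_assoc, add_mul, one_mul, mul_assoc, mul_inv_cancel₀ hcw0, mul_one,
      add_comm]
  have ay := abs_lt.1 (abs_arg_lt_pi_div_two_iff.2 (Or.inl hy))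
  have ax := abs_lt.1 (abs_arg_lt_pi_div_two_iff.2 (Or.inl hx))
  have hlog : log (n + x) = log y + log x := by
    rw [← hyx]
    exact log_mul hy0 hx0 ⟨by linarith, by linarith⟩
  have hsq : y ^ (-2 : ℤ) = exp (-2 * log y) := by
    rw [zpow_neg, neg_mul, Complex.exp_neg, two_mul, Complex.exp_add, exp_log hy0]
    congr 1
    exact zpow_two y
  have hlog2 : log (y ^ (-2 : ℤ)) = -2 * log y := by
    rw [hsq, log_exp]
    · simp only [mul_im, neg_im, neg_re, re_ofNat, im_ofNat, log_im]
      linarith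
    · simp only [mul_im, neg_im, neg_re, re_ofNat, im_ofNat, log_im]
      linarith
  rw [cpow_def_of_ne_zero (zpow_ne_zero _ hy0), hlog2, hlog, ← Complex.exp_add]
  congr 1
  ring

/-- The inverse of the coordinate x = 1/(c(1 - σz)) is z = σ - (σ/c)/x, so translation of x by t
gives the formula. This is where e = -σ/c comes from. -/
theorem parabolic_point_eq {σ c w z t : ℂ} (hσ : σ * σ = 1) (hc : c ≠ 0) (hw0 : w ≠ 0)
    (hw : w = 1 - σ * z) (ht : t + (c * w)⁻¹ ≠ 0) :
    σ + -σ / c * (t + (c * w)⁻¹)⁻¹ = (z + σ * (t * c * w)) / (1 + t * c * w) := by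
  have hcw : c * w ≠ 0 := mul_ne_zero hc hw0
  have h1 : t + (c * w)⁻¹ = (1 + t * c * w) / (c * w) := by
    rw [eq_div_iff hcw, add_mul, inv_mul_cancel₀ hcw]
    ring
  have h2 : 1 + t * c * w ≠ 0 := fun h => ht (by rw [h1, h, zero_div])
  have h3 : -σ / c * (c * w / (1 + t * c * w)) = -σ * w / (1 + t * c * w) := by
    field_simp
  rw [h1, inv_div, h3, eq_div_iff h2, add_mul, div_mul_cancel₀ _ h2, hw]
  linear_combination z * hσ

theorem setOf_two_mul_eq_poleSet : {s : ℂ | 2 * s ∈ {a : ℂ | ∃ k : ℕ, a = 1 - k}} = poleSet := by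
  ext s
  constructor
  · rintro ⟨k, hk⟩
    exact ⟨k, by linear_combination hk / 2⟩
  · rintro ⟨k, hk⟩
    exact ⟨k, by linear_combination 2 * hk⟩

theorem SimplePoleFamily.weighted {E X Y Z : Type} [NormedAddCommGroup E] [NormedSpace ℂ E]
    [NormedAddCommGroup X] [NormedSpace ℂ X] [NormedAddCommGroup Y] [NormedSpace ℂ Y]
    [NormedAddCommGroup Z] [NormedSpace ℂ Z] {r : ℕ} {T : ℂ → X →L[ℂ] Y}
    (h : SimplePoleFamily {a | ∃ k : ℕ, a = 1 - k} r T) (B : E →L[ℂ] Y →L[ℂ] Z) {u : ℂ → E}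
    (hu : Differentiable ℂ u) :
    SimplePoleFamily poleSet r fun s => (B (u (2 * s))).comp (T (2 * s)) := by
  rw [← setOf_two_mul_eq_poleSet]
  exact (h.comp_left (B.differentiable.comp hu)).comp_mul two_ne_zero

theorem ParabolicData.exists_weighted_family {Ω Ω' : Set ℂ} [IsBoundedOpen Ω]
    [IsBoundedOpen Ω'] {p e : ℂ} {x : BSpace Ω'} (D : ParabolicData Ω Ω' p e x) :
    ∃ T : ℂ → BSpace Ω →L[ℂ] BSpace Ω', SimplePoleFamily poleSet 1 T ∧
      ∀ s : ℂ, 1 / 2 < s.re → ∀ f, ∀ z ∈ closure Ω',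
        HasSum (fun n : ℕ => exp (2 * s * log (val x z)) *
          exp (-(2 * s) * log (((n + 1 : ℕ) : ℂ) + val x z)) *
            val f (p + e * (((n + 1 : ℕ) : ℂ) + val x z)⁻¹)) (val (T s f) z) := by
  obtain ⟨T, hT, hTsum⟩ := D.exists_simplePoleFamily
  -- `logShift` at index 0 is log x, so the weight is x^{2s}.
  refine ⟨_, hT.weighted (mulB Ω') (differentiable_expB (logShift D.re_pos 0)),
    fun s hs f z hz => ?_⟩
  have hs2 : 1 < (2 * s).re := by
    rw [mul_re, re_ofNat, im_ofNat]
    linarith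
  have h1 := (D.hasSum_parSum hs2 f hz).mul_left (exp (2 * s * log (val x z)))
  rw [ContinuousLinearMap.comp_apply, hTsum _ hs2, val_mulB, val_expB _ _ hz,
    val_logShift D.re_pos _ hz, Nat.cast_zero, zero_add]
  refine h1.congr_fun fun n => ?_
  rw [val_powShift D.re_pos _ _ hz, mul_assoc]

theorem exists_parabolicData {Ω Ω' : Set ℂ} [IsBoundedOpen Ω'] {b : SL2R}
    {σ c : ℝ} (hσ : σ * σ = 1) (hc : 0 < c) (hb : HasParabolicPowers b σ c) (hp : (σ : ℂ) ∈ Ω)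
    (hre : ∀ z ∈ closure Ω', 0 < (1 - σ * z).re)
    (hmaps : ∀ n : ℕ, 1 ≤ n → MapsInto (b ^ n) (closure Ω') Ω) :
    ∃ x : BSpace Ω', (∀ z ∈ closure Ω', val x z = (c * (1 - σ * z))⁻¹) ∧
      (∀ n : ℕ, ∀ z ∈ closure Ω', (σ : ℂ) + -σ / c * (((n + 1 : ℕ) : ℂ) + val x z)⁻¹ =
        moeb (b ^ (n + 1)) z) ∧ ParabolicData Ω Ω' (σ : ℂ) (-σ / c) x := by
  have hne : ∀ z ∈ closure Ω', (1 - σ * z : ℂ) ≠ 0 := fun z hz h => by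
    have := hre z hz
    rw [h, zero_re] at this
    exact lt_irrefl _ this
  have hc0 : (c : ℂ) ≠ 0 := ofReal_ne_zero.2 hc.ne'
  have hcne : ∀ z ∈ closure Ω', (c * (1 - σ * z) : ℂ) ≠ 0 := fun z hz =>
    mul_ne_zero hc0 (hne z hz)
  have hxd : DifferentiableOn ℂ (fun z : ℂ => (c * (1 - σ * z))⁻¹) (closure Ω') :=
    (((differentiable_id.const_mul _).const_sub 1).const_mul _).differentiableOn.inv hcne
  have hx : ∀ z ∈ closure Ω', val (ofFun _ hxd.continuousOn (hxd.mono subset_closure)) z =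
      (c * (1 - σ * z))⁻¹ := fun z hz =>
    val_ofFun hxd.continuousOn (hxd.mono subset_closure) hz
  generalize ofFun _ hxd.continuousOn (hxd.mono subset_closure) = x at hx
  have hxre : ∀ z ∈ closure Ω', 0 < (val x z).re := fun z hz => by
    rw [hx z hz, inv_re]
    refine div_pos ?_ (normSq_pos.2 (hcne z hz))
    rw [re_ofReal_mul]
    exact mul_pos hc (hre z hz)
  have hσ' : (σ : ℂ) * σ = 1 := by exact_mod_cast hσ
  have hpoint : ∀ (n : ℕ), ∀ z ∈ closure Ω', (σ : ℂ) + -σ / c * (((n + 1 : ℕ) : ℂ) + val x z)⁻¹ =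
      moeb (b ^ (n + 1)) z := by
    intro n z hz
    obtain ⟨ε, -, -, hmoeb⟩ := hb (n + 1) z
    have h1 := natCast_add_ne_zero (hxre z hz) (n + 1)
    rw [hx z hz] at h1
    rw [hmoeb, hx z hz]
    exact parabolic_point_eq hσ' hc0 (hne z hz) rfl h1
  exact ⟨x, hx, hpoint, hp, hxre, fun n z hz => by
    rw [hpoint n z hz]
    exact (hmaps (n + 1) (Nat.le_add_left 1 n) z hz).2⟩

theorem exists_parabolic_family {Ω Ω' : Set ℂ} [IsBoundedOpen Ω] [IsBoundedOpen Ω'] {b : SL2R}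
    {σ c : ℝ} (hσ : σ * σ = 1) (hc : 0 < c) (hb : HasParabolicPowers b σ c) (hp : (σ : ℂ) ∈ Ω)
    (hre : ∀ z ∈ closure Ω', 0 < (1 - σ * z).re)
    (hmaps : ∀ n : ℕ, 1 ≤ n → MapsInto (b ^ n) (closure Ω') Ω) :
    ∃ T : ℂ → BSpace Ω →L[ℂ] BSpace Ω', SimplePoleFamily poleSet 1 T ∧
      ∀ s : ℂ, 1 / 2 < s.re → ∀ f, ∀ z ∈ closure Ω',
        HasSum (fun n : ℕ => jfac s (b ^ (n + 1)) z * val f (moeb (b ^ (n + 1)) z))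
          (val (T s f) z) := by
  obtain ⟨x, hx, hpoint, D⟩ := exists_parabolicData hσ hc hb hp hre hmaps
  obtain ⟨T, hT, hsum⟩ := D.exists_weighted_family
  refine ⟨T, hT, fun s hs f z hz => (hsum s hs f z hz).congr_fun fun n => ?_⟩
  obtain ⟨ε, hε, hden, -⟩ := hb (n + 1) z
  -- The sign of the matrix representative disappears in the even power.
  have hε2 : ε ^ (-2 : ℤ) = 1 := by
    rw [zpow_neg, show ε ^ (2 : ℤ) = ε ^ 2 from zpow_ofNat ε 2, hε, inv_one]
  rw [hpoint n z hz, jfac, hden, mul_zpow, hε2, one_mul, cpow_neg_two_eq (hre z hz) hc, hx z hz]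

/-! ## Matrix computations -/

theorem coe_conj_calT (M : SL2R) :
    ((calT * M * calT⁻¹ : SL2R) : Matrix (Fin 2) (Fin 2) ℝ) =
      !![(M 0 0 - M 1 0 - M 0 1 + M 1 1) / 2, (M 0 0 - M 1 0 + M 0 1 - M 1 1) / 2;
        (M 0 0 + M 1 0 - M 0 1 - M 1 1) / 2, (M 0 0 + M 1 0 + M 0 1 + M 1 1) / 2] := by
  have h2 : (√2 : ℝ) ^ 2 = 2 := Real.sq_sqrt (by norm_num)
  have h0 : (√2 : ℝ) ≠ 0 := by positivity
  rw [Matrix.SpecialLinearGroup.coe_mul, Matrix.SpecialLinearGroup.coe_mul,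
    Matrix.SpecialLinearGroup.coe_inv, Matrix.eta_fin_two (M : Matrix (Fin 2) (Fin 2) ℝ)]
  simp only [calT, Matrix.adjugate_fin_two_of, Matrix.mul_fin_two]
  ext i j
  fin_cases i <;> fin_cases j <;> simp <;> field_simp <;> rw [h2] <;> ring

theorem h_inv (q k : ℕ) : (h q k)⁻¹ = calT * (U q ^ k * S) * calT⁻¹ := by
  simp only [h, g, mul_inv_rev, inv_inv, mul_assoc]

/-- Up to sign US is the translation by λ; conjugation by 𝒯 moves its fixed point ∞ to 1. -/
theorem coe_h_one_inv (q : ℕ) :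
    (((h q 1)⁻¹ : SL2R) : Matrix (Fin 2) (Fin 2) ℝ) =
      -!![1 - lam q / 2, lam q / 2; -(lam q / 2), 1 + lam q / 2] := by
  have hUS : ((U q ^ 1 * S : SL2R) : Matrix (Fin 2) (Fin 2) ℝ) = !![-1, -lam q; 0, -1] := by
    rw [pow_one, Matrix.SpecialLinearGroup.coe_mul]
    simp [U, S]
  rw [h_inv, coe_conj_calT, hUS]
  ext i j
  fin_cases i <;> fin_cases j <;> simp <;> ring

/-- U has trace 2 cos θ with θ = π/q, so its powers obey the Chebyshev recursion of sin(nθ)/sin θ.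
The exponent n + 1 avoids negative indices. -/
theorem coe_U_pow (q : ℕ) (hq : 2 ≤ q) (n : ℕ) :
    ((U q ^ (n + 1) : SL2R) : Matrix (Fin 2) (Fin 2) ℝ) =
      (Real.sin (Real.pi / q))⁻¹ • !![Real.sin ((n + 2) * (Real.pi / q)),
        -Real.sin ((n + 1) * (Real.pi / q)); Real.sin ((n + 1) * (Real.pi / q)),
        -Real.sin (n * (Real.pi / q))] := by
  set θ := Real.pi / q with hθ
  have hq' : (2 : ℝ) ≤ q := by exact_mod_cast hq
  have hs : Real.sin θ ≠ 0 := by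
    refine (Real.sin_pos_of_pos_of_lt_pi (by positivity) ?_).ne'
    rw [hθ, div_lt_iff₀ (by linarith)]
    nlinarith [Real.pi_pos]
  have hl : lam q = 2 * Real.cos θ := rfl
  induction n with
  | zero =>
    rw [zero_add, pow_one]
    simp only [U, hl, Nat.cast_zero, zero_add, one_mul, zero_mul, Real.sin_zero, neg_zero,
      Real.sin_two_mul]
    ext i j
    fin_cases i <;> fin_cases j <;> simp <;> field_simp
  | succ n ih =>
    have hrec : ∀ t : ℝ, Real.sin (t + 2 * θ) = 2 * Real.cos θ * Real.sin (t + θ) - Real.sin t := by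
      intro t
      rw [Real.sin_add, Real.sin_add, Real.sin_two_mul, Real.cos_two_mul]
      ring
    have h3 := hrec ((n + 1) * θ)
    have h2 := hrec (n * θ)
    rw [pow_succ', Matrix.SpecialLinearGroup.coe_mul, ih]
    simp only [U, hl, Matrix.mul_smul, Matrix.mul_fin_two]
    congr 1
    push_cast
    rw [show ((n : ℝ) + 1 + 2) * θ = (n + 1) * θ + 2 * θ by ring, h3,
      show ((n : ℝ) + 1 + 1) * θ = n * θ + 2 * θ by ring, h2,
      show ((n : ℝ) + 2) * θ = n * θ + 2 * θ by ring, h2,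
      show ((n : ℝ) + 1) * θ + θ = n * θ + 2 * θ by ring, h2,
      show ((n : ℝ) + 1) * θ = n * θ + θ by ring]
    ext i j
    fin_cases i <;> fin_cases j <;> simp <;> ring

/-- The values sin(qθ) = 0, sin((q-1)θ) = sin θ and sin((q-2)θ) = sin 2θ make U^{q-1}S lower
triangular and parabolic. Its fixed point 0 is moved to -1 by 𝒯. -/
theorem coe_h_last_inv (q : ℕ) (hq : 3 ≤ q) :
    (((h q (q - 1))⁻¹ : SL2R) : Matrix (Fin 2) (Fin 2) ℝ) =
      -!![1 - lam q / 2, -(lam q / 2); lam q / 2, 1 + lam q / 2] := by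
  obtain ⟨m, rfl⟩ : ∃ m, q = m + 2 := ⟨q - 2, by omega⟩
  set q := m + 2 with hqm
  have hq0 : (q : ℝ) ≠ 0 := by
    have : q ≠ 0 := by omega
    exact_mod_cast this
  have hqr : (q : ℝ) = m + 2 := by rw [hqm]; push_cast; ring
  have hs : Real.sin (Real.pi / q) ≠ 0 := by
    refine (Real.sin_pos_of_pos_of_lt_pi (by positivity) ?_).ne'
    have h3 : (3 : ℝ) ≤ q := by exact_mod_cast hq
    rw [div_lt_iff₀ (by linarith)]
    nlinarith [Real.pi_pos]
  have hpi : (q : ℝ) * (Real.pi / q) = Real.pi := by field_simp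
  have e2 : Real.sin (((m : ℝ) + 2) * (Real.pi / q)) = 0 := by
    rw [← hqr, hpi, Real.sin_pi]
  have e1 : Real.sin (((m : ℝ) + 1) * (Real.pi / q)) = Real.sin (Real.pi / q) := by
    rw [show ((m : ℝ) + 1) * (Real.pi / q) = Real.pi - Real.pi / q by
      rw [show ((m : ℝ) + 1) = q - 1 by rw [hqr]; ring, sub_mul, hpi, one_mul], Real.sin_pi_sub]
  have e0 : Real.sin ((m : ℝ) * (Real.pi / q)) =
      2 * Real.sin (Real.pi / q) * Real.cos (Real.pi / q) := by
    rw [show (m : ℝ) * (Real.pi / q) = Real.pi - 2 * (Real.pi / q) by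
      rw [show (m : ℝ) = q - 2 by rw [hqr]; ring, sub_mul, hpi], Real.sin_pi_sub,
      Real.sin_two_mul]
  have hU : ((U q ^ (q - 1) * S : SL2R) : Matrix (Fin 2) (Fin 2) ℝ) =
      !![-1, 0; -lam q, -1] := by
    rw [show q - 1 = m + 1 by omega, Matrix.SpecialLinearGroup.coe_mul,
      coe_U_pow q (by omega) m, e2, e1, e0]
    simp only [S, Matrix.smul_mul, Matrix.mul_fin_two]
    ext i j
    fin_cases i <;> fin_cases j <;> simp [lam] <;> field_simp
  rw [h_inv, coe_conj_calT, hU]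
  ext i j
  fin_cases i <;> fin_cases j <;> simp <;> ring

/-- Here -b = 1 + cN, and N² = 0 because σ² = 1; hence (-b)^n = 1 + ncN. -/
theorem coe_pow_of_coe_eq {b : SL2R} {σ c : ℝ} (hσ : σ * σ = 1)
    (hb : (b : Matrix (Fin 2) (Fin 2) ℝ) = -!![1 - c, σ * c; -(σ * c), 1 + c]) (n : ℕ) :
    ((b ^ n : SL2R) : Matrix (Fin 2) (Fin 2) ℝ) =
      (-1 : ℝ) ^ n • !![1 - n * c, σ * (n * c); -(σ * (n * c)), 1 + n * c] := by
  induction n with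
  | zero =>
    ext i j
    fin_cases i <;> fin_cases j <;> simp
  | succ n ih =>
    rw [pow_succ, Matrix.SpecialLinearGroup.coe_mul, ih, hb]
    simp only [Matrix.mul_neg, Matrix.smul_mul, Matrix.mul_fin_two]
    rw [pow_succ, mul_neg_one, neg_smul]
    congr 2
    ext i j
    fin_cases i <;> fin_cases j <;> simp
    · linear_combination (-(n * c * c : ℝ)) * hσ
    · ring
    · ring
    · linear_combination (-(n * c * c : ℝ)) * hσ

theorem hasParabolicPowers_of_coe_eq {b : SL2R} {σ c : ℝ} (hσ : σ * σ = 1)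
    (hb : (b : Matrix (Fin 2) (Fin 2) ℝ) = -!![1 - c, σ * c; -(σ * c), 1 + c]) :
    HasParabolicPowers b σ c := by
  intro n z
  have hM := coe_pow_of_coe_eq hσ hb n
  have h00 : (b ^ n) 0 0 = (-1) ^ n * (1 - n * c) := by
    simpa using congrFun (congrFun hM 0) 0
  have h01 : (b ^ n) 0 1 = (-1) ^ n * (σ * (n * c)) := by
    simpa using congrFun (congrFun hM 0) 1
  have h10 : (b ^ n) 1 0 = (-1) ^ n * (-(σ * (n * c))) := by
    simpa using congrFun (congrFun hM 1) 0
  have h11 : (b ^ n) 1 1 = (-1) ^ n * (1 + n * c) := by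
    simpa using congrFun (congrFun hM 1) 1
  have hσ' : (σ : ℂ) * σ = 1 := by exact_mod_cast hσ
  have hden : den (b ^ n) z = (-1) ^ n * (1 + n * c * (1 - σ * z)) := by
    rw [den, h10, h11]
    push_cast
    ring
  refine ⟨(-1) ^ n, by rw [← pow_mul, mul_comm, pow_mul]; simp, hden, ?_⟩
  rw [moeb, hden, h00, h01]
  push_cast
  rw [← mul_div_mul_left (z + σ * (n * c * (1 - σ * z))) _
    (pow_ne_zero n (neg_ne_zero.2 (one_ne_zero (α := ℂ))))]
  congr 1
  linear_combination (-1 : ℂ) ^ n * n * c * z * hσ'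

theorem lam_pos {q : ℕ} (hq : 3 ≤ q) : 0 < lam q := by
  have h3 : (3 : ℝ) ≤ q := by exact_mod_cast hq
  refine mul_pos two_pos (Real.cos_pos_of_mem_Ioo ⟨?_, ?_⟩)
  · have : 0 < Real.pi / q := by positivity
    linarith [Real.pi_pos]
  · rw [div_lt_iff₀ (by linarith)]
    nlinarith [Real.pi_pos]

theorem hasParabolicPowers_h_one (q : ℕ) : HasParabolicPowers (h q 1)⁻¹ 1 (lam q / 2) :=
  hasParabolicPowers_of_coe_eq (one_mul 1) (by rw [coe_h_one_inv, one_mul])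

theorem hasParabolicPowers_h_last {q : ℕ} (hq : 3 ≤ q) :
    HasParabolicPowers (h q (q - 1))⁻¹ (-1) (lam q / 2) :=
  hasParabolicPowers_of_coe_eq (by norm_num) (by rw [coe_h_last_inv q hq]; simp)

/-- The parabolic fixed point is an endpoint of E_1, so it lies in the closure, which the domain
contains. The Taylor step at p depends on this. -/
theorem ofReal_one_mem_of_admissible {q : ℕ} (hq : 3 ≤ q) {D : Idx → Set ℂ}
    (hD : Admissible q D) : ((1 : ℝ) : ℂ) ∈ D .one := by
  refine hD.closure_subset .one ?_
  have hl := lam_pos hq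
  have hlt : (lam q - 1) / (lam q + 1) < 1 := by
    rw [div_lt_one (by linarith)]
    linarith
  refine image_closure_subset_closure_image continuous_ofReal (mem_image_of_mem _ ?_)
  rw [closure_Ioo hlt.ne]
  exact right_mem_Icc.2 hlt.le

theorem ofReal_neg_one_mem_of_admissible {q : ℕ} (hq : 3 ≤ q) {D : Idx → Set ℂ}
    (hD : Admissible q D) : ((-1 : ℝ) : ℂ) ∈ D .last := by
  rw [← hD.neg_one]
  exact ⟨_, ofReal_one_mem_of_admissible hq hD, by simp⟩

/-! ## Assembling the operator -/

section Blocks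

variable {E : Idx → Type} [∀ j, NormedAddCommGroup (E j)] [∀ j, NormedSpace ℂ (E j)]

open Classical in
/-- The operator on the product with a single non-zero block `T`, from the component `i` to the
component `j`. -/
def blockOp {i j : Idx} (T : E i →L[ℂ] E j) : (∀ j, E j) →L[ℂ] (∀ j, E j) :=
  (ContinuousLinearMap.single ℂ E j).comp (T.comp (ContinuousLinearMap.proj i))

theorem blockOp_apply_self {i j : Idx} (T : E i →L[ℂ] E j) (f : ∀ j, E j) :
    blockOp T f j = T (f i) := by
  classical
  exact Pi.single_eq_same j (T (f i))

theorem blockOp_apply_of_ne {i j k : Idx} (h : k ≠ j) (T : E i →L[ℂ] E j) (f : ∀ j, E j) :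
    blockOp T f k = 0 := by
  classical
  exact Pi.single_eq_of_ne h (T (f i))

theorem SimplePoleFamily.block {P : Set ℂ} {r : ℕ} {i j : Idx} {T : ℂ → E i →L[ℂ] E j}
    (h : SimplePoleFamily P r T) : SimplePoleFamily P r fun s => blockOp (T s) := by
  classical
  exact (h.comp_right (ContinuousLinearMap.proj i)).comp_left
    (differentiable_const (ContinuousLinearMap.single ℂ E j))

/-- Each of the four parabolic blocks contributes polar rank at most one and the entire blocks
contribute none; ranks add up to 4. -/
theorem exists_blockFamily {P : Set ℂ} {T₁ : ℂ → E .one →L[ℂ] E .mid}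
    {T₂ : ℂ → E .one →L[ℂ] E .last} {T₃ : ℂ → E .last →L[ℂ] E .one}
    {T₄ : ℂ → E .last →L[ℂ] E .mid} {H : ∀ j, ℂ → E .mid →L[ℂ] E j}
    (h₁ : SimplePoleFamily P 1 T₁) (h₂ : SimplePoleFamily P 1 T₂)
    (h₃ : SimplePoleFamily P 1 T₃) (h₄ : SimplePoleFamily P 1 T₄)
    (hH : ∀ j, SimplePoleFamily P 0 (H j)) :
    ∃ L : ℂ → (∀ j, E j) →L[ℂ] (∀ j, E j), SimplePoleFamily P 4 L ∧
      (∀ s f, L s f .one = H .one s (f .mid) + T₃ s (f .last)) ∧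
      (∀ s f, L s f .mid = T₁ s (f .one) + H .mid s (f .mid) + T₄ s (f .last)) ∧
      ∀ s f, L s f .last = T₂ s (f .one) + H .last s (f .mid) := by
  refine ⟨_, (((h₁.block.add h₂.block).add (h₃.block.add h₄.block)).add
    ((hH .one).block.add ((hH .mid).block.add (hH .last).block))), fun s f => ?_,
    fun s f => ?_, fun s f => ?_⟩
  · change blockOp (T₁ s) f .one + blockOp (T₂ s) f .one + (blockOp (T₃ s) f .one +
      blockOp (T₄ s) f .one) + (blockOp (H .one s) f .one + (blockOp (H .mid s) f .one +
      blockOp (H .last s) f .one)) = _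
    rw [blockOp_apply_self, blockOp_apply_self, blockOp_apply_of_ne (by simp),
      blockOp_apply_of_ne (by simp), blockOp_apply_of_ne (by simp), blockOp_apply_of_ne (by simp),
      blockOp_apply_of_ne (by simp)]
    abel
  · change blockOp (T₁ s) f .mid + blockOp (T₂ s) f .mid + (blockOp (T₃ s) f .mid +
      blockOp (T₄ s) f .mid) + (blockOp (H .one s) f .mid + (blockOp (H .mid s) f .mid +
      blockOp (H .last s) f .mid)) = _
    rw [blockOp_apply_self, blockOp_apply_self, blockOp_apply_self, blockOp_apply_of_ne (by simp),
      blockOp_apply_of_ne (by simp), blockOp_apply_of_ne (by simp), blockOp_apply_of_ne (by simp)]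
    abel
  · change blockOp (T₁ s) f .last + blockOp (T₂ s) f .last + (blockOp (T₃ s) f .last +
      blockOp (T₄ s) f .last) + (blockOp (H .one s) f .last + (blockOp (H .mid s) f .last +
      blockOp (H .last s) f .last)) = _
    rw [blockOp_apply_self, blockOp_apply_self, blockOp_apply_of_ne (by simp),
      blockOp_apply_of_ne (by simp), blockOp_apply_of_ne (by simp), blockOp_apply_of_ne (by simp),
      blockOp_apply_of_ne (by simp)]
    abel

end Blocks

/-! ### The set of poles -/

theorem le_dist_of_mem_poleSet {s t : ℂ} (hs : s ∈ poleSet) (ht : t ∈ poleSet) (hne : s ≠ t) :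
    1 / 2 ≤ dist s t := by
  obtain ⟨k, rfl⟩ := hs
  obtain ⟨l, rfl⟩ := ht
  have hkl : (k : ℤ) - l ≠ 0 := fun h => hne (by
    rw [show k = l by omega])
  have h1 : (1 : ℝ) ≤ |(k : ℝ) - l| := by exact_mod_cast Int.one_le_abs hkl
  rw [dist_eq_norm, show (1 - (k : ℂ)) / 2 - (1 - (l : ℂ)) / 2 =
    (((l : ℝ) - k) / 2 : ℝ) by push_cast; ring, norm_real, Real.norm_eq_abs, abs_div, abs_sub_comm]
  norm_num
  linarith

theorem isClosed_poleSet : IsClosed poleSet :=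
  Metric.isClosed_of_pairwise_le_dist (ε := 1 / 2) (by norm_num) fun _ hs _ ht hne =>
    le_dist_of_mem_poleSet hs ht hne

theorem isDiscrete_poleSet : IsDiscrete poleSet :=
  ⟨DiscreteTopology.of_forall_le_dist (r := 1 / 2) (by norm_num) fun s t hne =>
    le_dist_of_mem_poleSet s.2 t.2 fun h => hne (Subtype.ext h)⟩

/-! ### Scalar consequences -/

section Scalar

variable {X Y : Type} [NormedAddCommGroup X] [NormedSpace ℂ X]
  [NormedAddCommGroup Y] [NormedSpace ℂ Y] {P : Set ℂ} {r : ℕ} {T : ℂ → X →L[ℂ] Y}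

theorem SimplePoleFamily.differentiableOn_apply (h : SimplePoleFamily P r T) (ψ : Y →L[ℂ] ℂ)
    (f : X) : DifferentiableOn ℂ (fun s => ψ (T s f)) Pᶜ := fun s hs =>
  (ψ.differentiableAt.comp s ((h.differentiableAt s hs).clm_apply
    (differentiableAt_const f))).differentiableWithinAt

theorem SimplePoleFamily.exists_eventuallyEq (h : SimplePoleFamily P r T) (ψ : Y →L[ℂ] ℂ) (f : X)
    {s₀ : ℂ} (hs₀ : s₀ ∈ P) : ∃ g : ℂ → ℂ, AnalyticAt ℂ g s₀ ∧
      (fun s => ψ (T s f)) =ᶠ[𝓝[≠] s₀] fun s => (s - s₀) ^ (-1 : ℤ) * g s := by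
  obtain ⟨V, A, B, hV, hmem, hA, hB, hT, -⟩ := h.exists_local s₀ hs₀
  have hsc : ∀ {C : ℂ → X →L[ℂ] Y}, DifferentiableOn ℂ C V →
      DifferentiableOn ℂ (fun s => ψ (C s f)) V := fun hC =>
    ψ.differentiable.comp_differentiableOn (hC.clm_apply (differentiableOn_const f))
  refine ⟨fun s => ψ (A s f) + (s - s₀) * ψ (B s f), ?_, ?_⟩
  · exact ((hsc hA).add ((differentiableOn_id.sub_const s₀).mul (hsc hB))).analyticAt
      (hV.mem_nhds hmem)
  · filter_upwards [self_mem_nhdsWithin, mem_nhdsWithin_of_mem_nhds (hV.mem_nhds hmem)]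
      with s hne hs
    have h0 : s - s₀ ≠ 0 := sub_ne_zero.2 hne
    rw [hT s hs hne, zpow_neg_one]
    change ψ ((s - s₀)⁻¹ • A s f + B s f) = (s - s₀)⁻¹ * (ψ (A s f) + (s - s₀) * ψ (B s f))
    rw [map_add, map_smul, smul_eq_mul, mul_add, inv_mul_cancel_left₀ h0]

theorem SimplePoleFamily.meromorphicAt_apply (h : SimplePoleFamily P r T) (hP : IsClosed P)
    (ψ : Y →L[ℂ] ℂ) (f : X) (s₀ : ℂ) : MeromorphicAt (fun s => ψ (T s f)) s₀ := by
  by_cases hs₀ : s₀ ∈ P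
  · obtain ⟨g, hg, heq⟩ := h.exists_eventuallyEq ψ f hs₀
    have h1 : MeromorphicAt (fun s : ℂ => s - s₀) s₀ :=
      (analyticAt_id.sub analyticAt_const).meromorphicAt
    exact ((h1.zpow (-1)).mul hg.meromorphicAt).congr heq.symm
  · exact ((h.differentiableOn_apply ψ f).analyticAt
      (hP.isOpen_compl.mem_nhds hs₀)).meromorphicAt

theorem SimplePoleFamily.neg_one_le_meromorphicOrderAt (h : SimplePoleFamily P r T)
    (ψ : Y →L[ℂ] ℂ) (f : X) {s₀ : ℂ} (hs₀ : s₀ ∈ P) :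
    -1 ≤ meromorphicOrderAt (fun s => ψ (T s f)) s₀ := by
  obtain ⟨g, hg, heq⟩ := h.exists_eventuallyEq ψ f hs₀
  have h1 : MeromorphicAt (fun s : ℂ => s - s₀) s₀ :=
    (analyticAt_id.sub analyticAt_const).meromorphicAt
  have h2 : MeromorphicAt (fun s : ℂ => (s - s₀) ^ (-1 : ℤ)) s₀ := h1.zpow (-1)
  rw [meromorphicOrderAt_congr heq, fun_meromorphicOrderAt_mul h2 hg.meromorphicAt,
    fun_meromorphicOrderAt_zpow_id_sub_const]
  exact le_add_of_nonneg_right hg.meromorphicOrderAt_nonneg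

end Scalar

/-- Norm continuity in s is uniform in z; joint continuity follows by comparing g(s') with the fixed
continuous function g(s). -/
theorem continuousOn_val_uncurry {Ω : Set ℂ} {U : Set ℂ} {g : ℂ → BSpace Ω}
    (hg : ContinuousOn g U) : ContinuousOn (fun p : ℂ × ℂ => val (g p.1) p.2) (U ×ˢ Ω) := by
  rintro ⟨s, z⟩ ⟨hs, hz⟩
  have h1 : Tendsto (fun p : ℂ × ℂ => val (g s) p.2) (𝓝[U ×ˢ Ω] (s, z)) (𝓝 (val (g s) z)) := by
    refine (((continuousOn_val (g s)).mono subset_closure) z hz).tendsto.comp ?_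
    exact (continuousWithinAt_snd.tendsto_nhdsWithin fun p hp => hp.2)
  have h2 : Tendsto (fun p : ℂ × ℂ => val (g p.1 - g s) p.2) (𝓝[U ×ˢ Ω] (s, z)) (𝓝 0) := by
    refine squeeze_zero_norm (fun p => norm_val_le _ _) ?_
    have h3 : Tendsto (fun t => ‖g t - g s‖) (𝓝[U] s) (𝓝 0) :=
      tendsto_iff_norm_sub_tendsto_zero.1 (hg s hs).tendsto
    exact h3.comp (continuousWithinAt_fst.tendsto_nhdsWithin fun p hp => hp.1)
  have h4 := h1.add h2
  rw [add_zero] at h4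
  refine h4.congr fun p => ?_
  rw [val_sub]
  ring

/-! ### The components -/

section Components

variable {q : ℕ} {D : Idx → Set ℂ}

theorem exists_hypSum_family [∀ j, IsBoundedOpen (D j)] (hD : Admissible q D) (j : Idx) :
    ∃ H : ℂ → BSpace (D .mid) →L[ℂ] BSpace (D j), SimplePoleFamily poleSet 0 H ∧
      ∀ s f, ∀ z ∈ closure (D j), val (H s f) z = hypSum q s (val f) z := by
  choose! H hd hn hval using fun k (hk : k ∈ Finset.Icc 2 (q - 2)) =>
    exists_hyperbolic_family (hD.maps_hyp k hk j) (hD.branch k hk j)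
  refine ⟨fun s => ∑ k ∈ Finset.Icc 2 (q - 2), H k s, SimplePoleFamily.of_entire _ ?_ ?_, ?_⟩
  · exact Differentiable.fun_sum hd
  · exact fun s => IsNuclearOfOrderZero.sum _ fun k hk => hn k hk s
  · intro s f z hz
    rw [sum_apply, val_sum, hypSum]
    exact Finset.sum_congr rfl fun k hk => hval k hk s f z hz

theorem hasSum_parTerm {Ω Ω' : Set ℂ} {a : SL2R} {s : ℂ} {f : BSpace Ω} {F : BSpace Ω'} {z : ℂ}
    (h : HasSum (fun n : ℕ => jfac s (a⁻¹ ^ (n + 1)) z * val f (moeb (a⁻¹ ^ (n + 1)) z))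
      (val F z)) : HasSum (parTerm s a (val f) z) (val F z) :=
  h.congr_fun fun n => by rw [parTerm, tau, inv_pow]

theorem exists_transferFamily (hq : 3 ≤ q) (hD : Admissible q D) :
    ∃ L : ℂ → BProd D →L[ℂ] BProd D, SimplePoleFamily poleSet 4 L ∧
      ∀ s : ℂ, 1 / 2 < s.re → IsTransferOperator q D s (L s) := by
  have inst : ∀ j, IsBoundedOpen (D j) := fun j => ⟨hD.isOpen j, hD.isBounded j⟩
  have hc : 0 < lam q / 2 := half_pos (lam_pos hq)
  have h1 := ofReal_one_mem_of_admissible hq hD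
  have h2 := ofReal_neg_one_mem_of_admissible hq hD
  -- The half-plane conditions on the domains become Re(1 - σz) > 0, which puts x in the right
  -- half-plane.
  have hre1 : ∀ z : ℂ, (1 - ((1 : ℝ) : ℂ) * z).re = 1 - z.re := fun z => by simp
  have hre2 : ∀ z : ℂ, (1 - ((-1 : ℝ) : ℂ) * z).re = 1 + z.re := fun z => by simp
  obtain ⟨T₁, hT₁, hs₁⟩ := exists_parabolic_family (one_mul 1) hc (hasParabolicPowers_h_one q) h1
    (fun z hz => by rw [hre1]; linarith [(hD.re_mid z hz).2]) hD.maps_one_mid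
  obtain ⟨T₂, hT₂, hs₂⟩ := exists_parabolic_family (one_mul 1) hc (hasParabolicPowers_h_one q) h1
    (fun z hz => by rw [hre1]; linarith [hD.re_last z hz]) hD.maps_one_last
  obtain ⟨T₃, hT₃, hs₃⟩ := exists_parabolic_family (by norm_num) hc (hasParabolicPowers_h_last hq)
    h2 (fun z hz => by rw [hre2]; linarith [hD.re_one z hz]) hD.maps_last_one
  obtain ⟨T₄, hT₄, hs₄⟩ := exists_parabolic_family (by norm_num) hc (hasParabolicPowers_h_last hq)
    h2 (fun z hz => by rw [hre2]; linarith [(hD.re_mid z hz).1]) hD.maps_last_mid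
  choose H hH hHval using fun j => exists_hypSum_family hD j
  obtain ⟨L, hL, hone, hmid, hlast⟩ := exists_blockFamily (E := fun j => BSpace (D j))
    hT₁ hT₂ hT₃ hT₄ hH
  refine ⟨L, hL, fun s hs f j z hz => ?_⟩
  have hz' := subset_closure hz
  cases j with
  | one =>
    have e3 := hasSum_parTerm (hs₃ s hs (f .last) z hz')
    refine ⟨e3.summable, ?_⟩
    rw [hone, val_add, hHval _ _ _ z hz']
    simp only [transfer]
    rw [e3.tsum_eq]
  | mid =>
    have e1 := hasSum_parTerm (hs₁ s hs (f .one) z hz')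
    have e4 := hasSum_parTerm (hs₄ s hs (f .last) z hz')
    refine ⟨⟨e1.summable, e4.summable⟩, ?_⟩
    rw [hmid, val_add, val_add, hHval _ _ _ z hz']
    simp only [transfer]
    rw [e1.tsum_eq, e4.tsum_eq]
  | last =>
    have e2 := hasSum_parTerm (hs₂ s hs (f .one) z hz')
    refine ⟨e2.summable, ?_⟩
    rw [hlast, val_add, hHval _ _ _ z hz']
    simp only [transfer]
    rw [e2.tsum_eq]

/-- Evaluation of a component at a point, as a functional on the product. -/
def evalComponent (D : Idx → Set ℂ) (j : Idx) (z : ℂ) : BProd D →L[ℂ] ℂ :=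
  (evalCLM (D j) z).comp (ContinuousLinearMap.proj j)

theorem SimplePoleFamily.continuousOn_component {E : Idx → Type} [∀ j, NormedAddCommGroup (E j)]
    [∀ j, NormedSpace ℂ (E j)] {P : Set ℂ} {r : ℕ} {L : ℂ → (∀ j, E j) →L[ℂ] (∀ j, E j)}
    (h : SimplePoleFamily P r L) (f : ∀ j, E j) (j : Idx) :
    ContinuousOn (fun s => L s f j) Pᶜ := fun s hs =>
  ((continuous_apply j).continuousAt.comp (((h.differentiableAt s hs).clm_apply
    (differentiableAt_const f)).continuousAt)).continuousWithinAt

theorem SimplePoleFamily.isMeromorphicNuclearFamily {r : ℕ} {L : ℂ → BProd D →L[ℂ] BProd D}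
    (h : SimplePoleFamily poleSet r L) : IsMeromorphicNuclearFamily D poleSet L where
  isClosed := isClosed_poleSet
  discrete := isDiscrete_poleSet
  nuclear := h.nuclear
  meromorphic f j z _ s := h.meromorphicAt_apply isClosed_poleSet (evalComponent D j z) f s
  holomorphic f j z _ := h.differentiableOn_apply (evalComponent D j z) f
  continuous f j := continuousOn_val_uncurry (h.continuousOn_component f j)

end Components

end HeckeTransfer

end

theorem proposition4p13 (q : ℕ) (hq : 3 ≤ q) (D : HeckeTransfer.Idx → Set ℂ)
    (hD : HeckeTransfer.Admissible q D) :
    ∃ L : ℂ → HeckeTransfer.BProd D →L[ℂ] HeckeTransfer.BProd D,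
      -- an extension of the transfer operator family
      (∀ s : ℂ, 1 / 2 < s.re → HeckeTransfer.IsTransferOperator q D s (L s)) ∧
      -- meromorphic with values in nuclear operators of order zero, poles in the stated set
      HeckeTransfer.IsMeromorphicNuclearFamily D HeckeTransfer.poleSet L ∧
      -- all poles are simple
      (∀ s₀ ∈ HeckeTransfer.poleSet, ∀ f : HeckeTransfer.BProd D, ∀ j, ∀ z ∈ D j,
        -1 ≤ meromorphicOrderAt (fun s => HeckeTransfer.val (L s f j) z) s₀) ∧
      -- the local form near the poles
      (∀ s₀ ∈ HeckeTransfer.poleSet, ∃ (V : Set ℂ)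
        (A B : ℂ → HeckeTransfer.BProd D →L[ℂ] HeckeTransfer.BProd D),
        IsOpen V ∧ s₀ ∈ V ∧ DifferentiableOn ℂ A V ∧ DifferentiableOn ℂ B V ∧
        (∀ s ∈ V, s ≠ s₀ → L s = (s - s₀)⁻¹ • A s + B s) ∧
        (∀ s ∈ V, LinearMap.rank (A s : HeckeTransfer.BProd D →ₗ[ℂ] HeckeTransfer.BProd D) ≤ 4)) := by
  obtain ⟨L, hL, hT⟩ := HeckeTransfer.exists_transferFamily hq hD
  refine ⟨L, hT, hL.isMeromorphicNuclearFamily, fun s₀ hs₀ f j z _ =>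
    hL.neg_one_le_meromorphicOrderAt (HeckeTransfer.evalComponent D j z) f hs₀, fun s₀ hs₀ => ?_⟩
  obtain ⟨V, A, B, hV, hmem, hA, hB, heq, hr⟩ := hL.exists_local s₀ hs₀
  exact ⟨V, A, B, hV, hmem, hA, hB, heq, fun s hs => by simpa using hr s hs⟩
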